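/- Let $X_1,\dots,X_n$ ($n\ge 1$) be independent random variables, defined on a common probability space, with values in a measurable space $\mathcal X$, and let $\mathcal G$ be a collection of measurable functions $g:\mathcal X\to\mathbb R$. Write $P h:=\frac1n\sum_{i=1}^n\mathbb E\,h(X_i)$, $\|h\|:=(P h^2)^{1/2}$, and $\nu_n(g):=\sqrt n\,\bigl(\frac1n\sum_{i=1}^n g(X_i)-Pg\bigr)$. For $L>0$ and $z\ge 0$ let $\Psi_L(z):=\exp\bigl[\bigl((\sqrt{1+2Lz}-1)/L\bigr)^2\bigr]-1$, and for a real random variable $Z$ let $\|Z\|_{\Psi_L}:=\inf\{c>0:\ \mathbb E\,\Psi_L(|Z|/c)\le 1\}$ (with $\inf\emptyset=\infty$). *Brackets.* For measurable $l,u:\mathcal X\to\mathbb R$, the bracket $[l,u]$ contains $g$ if $l\le g\le u$ pointwise. For an integer $s\ge1$ let $\tilde N_s$ be the smallest cardinality of a finite collection of brackets with $\|u-l\|\le 2^{-s}$ for each of them, such that every $g\in\mathcal G$ is contained in one of them. Given $K$, let $\tilde N_0$ be the smallest cardinality of a finite collection of brackets with $P|u-l|^m\le\frac{m!}2(2K)^{m-2}$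 for each of them and all $m=2,3,\dots$, such that every $g\in\mathcal G$ is contained in one of them. These numbers are $\infty$ if no such finite collection exists. Put $N_s:=\prod_{k=0}^s\tilde N_k$. *Tree chains.* Let $S\ge 0$ be an integer. A finite labeled tree consists of a finite set of nodes that is the union of disjoint (possibly empty) generations $G_0,\dots,G_S$, a map parent from the nodes to the nodes with $\mathrm{parent}(j)\in G_{s-1}$ for $j\in G_s$, $s=1,\dots,S$, and a real random variable $W_j$ for each node $j$. The branch with end node $j_S\in G_S$ is the sequence $j_0,\dots,j_S$ with $j_{s-1}=\mathrm{parent}(j_s)$. For $\delta,\tau>0$ and $\mathcal L=(L_0,\dots,L_S)$ with all $L_s>0$, such a labeled tree is a $(\delta,\tau,\mathcal L)$ finite tree chain for a process $\{Z_\theta\}_{\theta\in\Theta}$ if $\|W_j\|_{\Psi_{L_s}}\le\tau2^{-s}$ for all $j\in G_s$, $s=0,\dots,S$, and if for each $\theta\in\Theta$ there is a (non-random) end node $j_S\in G_S$ whose branch satisfies $|Z_\theta|\le\sum_{s=0}^S|W_{j_s}|+\delta$ everywhere on the probability space. **Theorem.** Suppose that for some constant $K\ge1$ $$\sup_{g\in\mathcal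 G}P|g|^m\le\frac{m!}2K^{m-2},\qquad m=2,3,\dots.$$ Let $S\ge0$ be an integer, let $K_0\ge K_1\ge\dots\ge K_{S-1}>0$ be arbitrary constants, and suppose that $\tilde N_s<\infty$ for all $s=0,\dots,S$. Put $\tau:=3\sqrt6$, $$\delta:=4\sqrt n\sum_{s=1}^S\frac{2^{-2s}}{K_{s-1}}+\sqrt n\,2^{-S},\qquad L_0:=\frac{4\sqrt6\,K}{\sqrt n},\qquad L_s:=\frac{2\sqrt6\;2^sK_{s-1}}{3\sqrt n},\quad s=1,\dots,S.$$ Then there is a $(\delta,\tau,\mathcal L)$ finite tree chain for $\{\nu_n(g)\}_{g\in\mathcal G}$ with $|G_s|\le N_s$ for $s=0,\dots,S$. -/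

import Mathlib

open MeasureTheory ProbabilityTheory
open scoped ENNReal Nat

namespace BernsteinOrlicz

noncomputable section

/-- The function `Ψ_L (z) = exp [((√(1 + 2 L z) - 1) / L)²] - 1`, for `L > 0` and `z ≥ 0`. -/
def Psi (L z : ℝ) : ℝ :=
  Real.exp (((Real.sqrt (1 + 2 * L * z) - 1) / L) ^ 2) - 1

/-- The `Ψ`-Orlicz norm `inf {c > 0 : E Ψ(|Z| / c) ≤ 1}` of a random variable `Z`, as an extended
nonnegative number: it is `∞` when no such `c` exists. -/
def orliczNorm {Ω : Type*} [MeasurableSpace Ω] (Ψ : ℝ → ℝ) (Z : Ω → ℝ) (μ : Measure Ω) : ℝ≥0∞ :=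
  ⨅ (c : ℝ) (_ : 0 < c ∧ ∫⁻ ω, ENNReal.ofReal (Ψ (|Z ω| / c)) ∂μ ≤ 1), ENNReal.ofReal c

/-- The `L`-Bernstein-Orlicz norm. -/
def bernsteinOrliczNorm {Ω : Type*} [MeasurableSpace Ω] (L : ℝ) (Z : Ω → ℝ) (μ : Measure Ω) :
    ℝ≥0∞ :=
  orliczNorm (Psi L) Z μ

/-- A finite tree (a forest, in fact) with generations `G_0, …, G_S`: pairwise disjoint sets of
nodes whose union is the set of all `N` nodes, with a parent map that sends `G_s` to `G_{s-1}`
for `s = 1, …, S` (the parent of a node of `G_0` is irrelevant). -/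
structure FiniteTree (S : ℕ) where
  N : ℕ
  gen : Fin (S + 1) → Finset (Fin N)
  disjoint : ∀ s t, s ≠ t → Disjoint (gen s) (gen t)
  cover : ∀ j, ∃ s, j ∈ gen s
  parent : Fin N → Fin N
  parent_mem : ∀ (s : Fin S) (j : Fin N), j ∈ gen s.succ → parent j ∈ gen s.castSucc

/-- `b = (j_0, …, j_S)` is the branch of the tree with end node `j_S ∈ G_S`. -/
def FiniteTree.IsBranch {S : ℕ} (T : FiniteTree S) (b : Fin (S + 1) → Fin T.N) : Prop :=
  b (Fin.last S) ∈ T.gen (Fin.last S) ∧ ∀ s : Fin S, b s.castSucc = T.parent (b s.succ)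

/-- The tree `T` with labels `W` is a `(δ, τ, L)` finite tree chain for the process `Z`. -/
structure IsFiniteTreeChain {Ω Θ : Type*} [MeasurableSpace Ω] (μ : Measure Ω) {S : ℕ}
    (δ τ : ℝ) (L : Fin (S + 1) → ℝ) (Z : Θ → Ω → ℝ)
    (T : FiniteTree S) (W : Fin T.N → Ω → ℝ) : Prop where
  delta_pos : 0 < δ
  tau_pos : 0 < τ
  L_pos : ∀ s, 0 < L s
  measurable_label : ∀ j, Measurable (W j)
  norm_label_le : ∀ s, ∀ j ∈ T.gen s,
    bernsteinOrliczNorm (L s) (W j) μ ≤ ENNReal.ofReal (τ * 2⁻¹ ^ (s : ℕ))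
  chaining : ∀ θ, ∃ b, T.IsBranch b ∧ ∀ ω, |Z θ ω| ≤ ∑ s, |W (b s) ω| + δ

section EmpiricalProcess

variable {Ω 𝓧 : Type*} [MeasurableSpace Ω] [MeasurableSpace 𝓧] {n : ℕ}

/-- The averaged absolute moment `P|h|^m = (1/n) ∑ᵢ E |h(Xᵢ)|^m`, with values in `[0, ∞]`. -/
def absMoment (μ : Measure Ω) (X : Fin n → Ω → 𝓧) (m : ℕ) (h : 𝓧 → ℝ) : ℝ≥0∞ :=
  (∑ i, ∫⁻ ω, ENNReal.ofReal (|h (X i ω)| ^ m) ∂μ) / n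

/-- The norm `‖h‖ = ((1/n) ∑ᵢ E h(Xᵢ)²)^{1/2}`. -/
def avgNorm (μ : Measure Ω) (X : Fin n → Ω → 𝓧) (h : 𝓧 → ℝ) : ℝ≥0∞ :=
  (absMoment μ X 2 h) ^ (1 / 2 : ℝ)

/-- The empirical process `ν_n(g) = √n (P_n - P) g`. -/
def empiricalProcess (μ : Measure Ω) (X : Fin n → Ω → 𝓧) (g : 𝓧 → ℝ) (ω : Ω) : ℝ :=
  Real.sqrt n * ((1 / n) * ∑ i, g (X i ω) - (1 / n) * ∑ i, ∫ ω', g (X i ω') ∂μ)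

/-- The brackets `[lo j, up j]`, `j = 1, …, N`, form an `ε`-bracketing set for `𝓖`. -/
structure IsBracketingSet (μ : Measure Ω) (X : Fin n → Ω → 𝓧) (𝓖 : Set (𝓧 → ℝ)) (ε : ℝ)
    {N : ℕ} (lo up : Fin N → 𝓧 → ℝ) : Prop where
  measurable_lo : ∀ j, Measurable (lo j)
  measurable_up : ∀ j, Measurable (up j)
  size_le : ∀ j, avgNorm μ X (up j - lo j) ≤ ENNReal.ofReal ε
  exists_bracket : ∀ g ∈ 𝓖, ∃ j, lo j ≤ g ∧ g ≤ up j

/-- The brackets `[lo j, up j]`, `j = 1, …, N`, form a generalized bracketing set for `𝓖`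
with constant `K`. -/
structure IsGeneralizedBracketingSet (μ : Measure Ω) (X : Fin n → Ω → 𝓧) (𝓖 : Set (𝓧 → ℝ))
    (K : ℝ) {N : ℕ} (lo up : Fin N → 𝓧 → ℝ) : Prop where
  measurable_lo : ∀ j, Measurable (lo j)
  measurable_up : ∀ j, Measurable (up j)
  moment_le : ∀ j, ∀ m : ℕ, 2 ≤ m →
    absMoment μ X m (up j - lo j) ≤ ENNReal.ofReal ((m ! : ℝ) / 2 * (2 * K) ^ (m - 2))
  exists_bracket : ∀ g ∈ 𝓖, ∃ j, lo j ≤ g ∧ g ≤ up j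

/-- The cardinality `Ñ_s` of a minimal `2^{-s}`-bracketing set for `s ≥ 1`, and of a minimal
generalized bracketing set for `s = 0`; it is `∞` when there is no such set. -/
def bracketingNumber (μ : Measure Ω) (X : Fin n → Ω → 𝓧) (𝓖 : Set (𝓧 → ℝ)) (K : ℝ) (s : ℕ) :
    ℕ∞ :=
  if s = 0 then
    ⨅ (N : ℕ) (_ : ∃ lo up : Fin N → 𝓧 → ℝ, IsGeneralizedBracketingSet μ X 𝓖 K lo up), (N : ℕ∞)
  else
    ⨅ (N : ℕ) (_ : ∃ lo up : Fin N → 𝓧 → ℝ, IsBracketingSet μ X 𝓖 (2⁻¹ ^ s) lo up), (N : ℕ∞)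

end EmpiricalProcess

end

end BernsteinOrlicz

open BernsteinOrlicz

/-! The proof is chaining by brackets with adaptive truncation. Fix `g` and brackets `[l_k, u_k]`
around it, `k ≤ S`. Intersecting the first `s + 1` of them gives a lower envelope `Λ_s ≤ g` and a
width `w_s`, decreasing in `s`, with norm at most `2^{-s}`. Write `κ_s` for the truncation level
`K_s`, and stop each point at the first `s < S` with `w_s > κ_s`, or else at `S`. Telescoping writes
`g` as `Λ_0`, plus the increments `Λ_{s+1} - Λ_s` on points not yet stopped, plus `g - Λ_s` on
points stopped at `s` (`indicator_alive_eq`).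

An increment is at most `w_s ≤ κ_s`. A stopped remainder lies between `0` and the excess, that is
`w_s` restricted to the points stopped at `s`. Hence its empirical process is at most that of the
excess plus a bias `√n P(excess)` (`abs_empiricalProcess_le_of_le`). Since `w_s > κ_s` there, the
bias is at most `√n 2^{-2s} / κ_s`, and at depth `S` it is at most `√n 2^{-S}`. The biases add up to
`δ`.

What is left of generation `s` depends only on the brackets up to `s`, so the bracket index
sequences form the tree and give the count `N_s`. Each label is a sum of two terms. Bernstein's
inequality gives each a tail that `lintegral_Psi_le_one_of_tail` turns into a bound in `Ψ_L`, and
convexity of `Ψ_L` adds the two. -/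

/-! ### The function `Ψ_L` -/

theorem Psi_zero (L : ℝ) : Psi L 0 = 0 := by simp [Psi]

theorem Psi_nonneg (L z : ℝ) : 0 ≤ Psi L z := by
  have := Real.one_le_exp (sq_nonneg ((Real.sqrt (1 + 2 * L * z) - 1) / L))
  unfold Psi
  linarith

theorem measurable_Psi (L : ℝ) : Measurable (Psi L) := by
  unfold Psi
  fun_prop

/-- The exponent equals `(2/L²)(1 + Lz - √(1 + 2Lz))`, affine minus concave, and `exp` is convex and
increasing. This yields the triangle inequality for two labels sharing the same `L`. -/
theorem Psi_convexOn {L : ℝ} (hL : 0 < L) : ConvexOn ℝ (Set.Ici 0) (Psi L) := by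
  have h1 : ∀ z ∈ Set.Ici (0 : ℝ), ((Real.sqrt (1 + 2 * L * z) - 1) / L) ^ 2
      = (2 / L ^ 2) * ((1 + L * z) - Real.sqrt (1 + 2 * L * z)) := by
    intro z hz
    have hz : 0 ≤ z := hz
    have := Real.sq_sqrt (show 0 ≤ 1 + 2 * L * z by positivity)
    field_simp
    nlinarith
  refine ⟨convex_Ici 0, fun x hx y hy a b ha hb hab => ?_⟩
  have hx' : 0 ≤ x := hx
  have hy' : 0 ≤ y := hy
  have hxy : a • x + b • y ∈ Set.Ici (0 : ℝ) := by
    simp only [smul_eq_mul, Set.mem_Ici]; positivity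
  have hs := Real.strictConcaveOn_sqrt.concaveOn.2
    (show 1 + 2 * L * x ∈ Set.Ici (0 : ℝ) by simp only [Set.mem_Ici]; positivity)
    (show 1 + 2 * L * y ∈ Set.Ici (0 : ℝ) by simp only [Set.mem_Ici]; positivity) ha hb hab
  have he := convexOn_exp.2 (Set.mem_univ (((Real.sqrt (1 + 2 * L * x) - 1) / L) ^ 2))
    (Set.mem_univ (((Real.sqrt (1 + 2 * L * y) - 1) / L) ^ 2)) ha hb hab
  have hle : ((Real.sqrt (1 + 2 * L * (a • x + b • y)) - 1) / L) ^ 2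
      ≤ a • ((Real.sqrt (1 + 2 * L * x) - 1) / L) ^ 2
        + b • ((Real.sqrt (1 + 2 * L * y) - 1) / L) ^ 2 := by
    rw [h1 _ hxy, h1 x hx, h1 y hy]
    have e : a • (1 + 2 * L * x) + b • (1 + 2 * L * y) = 1 + 2 * L * (a • x + b • y) := by
      simp only [smul_eq_mul]; linear_combination hab
    rw [e] at hs
    simp only [smul_eq_mul] at hs ⊢
    have hc : 0 ≤ 2 / L ^ 2 := by positivity
    have := mul_le_mul_of_nonneg_left hs hc
    have e2 : 2 / L ^ 2 * (a * 1 + b * 1) = 2 / L ^ 2 := by rw [mul_one, mul_one, hab, mul_one]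
    nlinarith
  have := (Real.exp_le_exp.2 hle).trans he
  simp only [Psi, smul_eq_mul] at this ⊢
  linarith

/-- `√s + L s / 2` with `s = log (1 + t)` is a lower inverse of `Ψ_L`. -/
theorem le_of_le_Psi {L z t : ℝ} (hL : 0 < L) (hz : 0 ≤ z) (ht : 0 ≤ t) (h : t ≤ Psi L z) :
    Real.sqrt (Real.log (1 + t)) + L / 2 * Real.log (1 + t) ≤ z := by
  set s := Real.log (1 + t) with hs
  have hs0 : 0 ≤ s := Real.log_nonneg (by linarith)
  have h1 : s ≤ ((Real.sqrt (1 + 2 * L * z) - 1) / L) ^ 2 := by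
    rw [hs, Real.log_le_iff_le_exp (by linarith)]
    unfold Psi at h
    linarith
  have hq : 1 ≤ Real.sqrt (1 + 2 * L * z) := Real.one_le_sqrt.2 (by nlinarith [mul_nonneg hL.le hz])
  have h2 : Real.sqrt s ≤ (Real.sqrt (1 + 2 * L * z) - 1) / L :=
    Real.sqrt_le_iff.2 ⟨div_nonneg (by linarith) hL.le, h1⟩
  rw [le_div_iff₀ hL] at h2
  have h3 := Real.sq_sqrt (show 0 ≤ 1 + 2 * L * z by positivity)
  have h4 := Real.sq_sqrt hs0
  have h5 : (1 + Real.sqrt s * L) ^ 2 ≤ Real.sqrt (1 + 2 * L * z) ^ 2 := by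
    have := Real.sqrt_nonneg s
    gcongr
    linarith
  rw [h3] at h5
  have h6 : L * (Real.sqrt s + L / 2 * s) ≤ L * z := by
    have h7 : (Real.sqrt s * L) ^ 2 = s * L ^ 2 := by rw [mul_pow, h4]
    linarith
  exact le_of_mul_le_mul_left h6 hL

/-- The integrand is `2(1 + t)^{-3}`, with primitive `-(1 + t)^{-2}`. The power 3 makes the total
mass exactly 1 and is the source of the factor `√6 = √(2·3)` in the norms. -/
theorem lintegral_Ioi_two_mul_one_add_pow :
    ∫⁻ t in Set.Ioi (0 : ℝ), ENNReal.ofReal (2 * Real.exp (-(3 * Real.log (1 + t)))) = 1 := by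
  have hd : ∀ x ∈ Set.Ioi (0 : ℝ),
      HasDerivAt (fun t => -((1 + t) ^ 2)⁻¹) (2 * Real.exp (-(3 * Real.log (1 + x)))) x := by
    intro x hx
    have hx : 0 < x := hx
    have h1 : (1 + x) ≠ 0 := by positivity
    have h := (((hasDerivAt_id x).const_add 1).pow 2).inv (by
      have : (1 + x) ^ 2 ≠ 0 := pow_ne_zero 2 h1
      simpa using this)
    convert! h.neg using 1
    have : Real.exp (-(3 * Real.log (1 + x))) = ((1 + x) ^ 3)⁻¹ := by
      rw [Real.exp_neg, mul_comm, Real.exp_mul, Real.exp_log (by positivity)]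
      norm_cast
    rw [this]
    simp only [id, Pi.pow_apply]
    field_simp
    norm_num
  have hc : ContinuousWithinAt (fun t : ℝ => -((1 + t) ^ 2)⁻¹) (Set.Ici 0) 0 := by
    apply ContinuousAt.continuousWithinAt
    fun_prop (disch := norm_num)
  have ht : Filter.Tendsto (fun t : ℝ => -((1 + t) ^ 2)⁻¹) Filter.atTop (nhds 0) := by
    rw [← neg_zero]
    apply Filter.Tendsto.neg
    apply Filter.Tendsto.inv_tendsto_atTop
    exact (Filter.tendsto_pow_atTop (by norm_num)).comp
      (Filter.tendsto_atTop_add_const_left _ _ Filter.tendsto_id)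
  have hn : ∀ x ∈ Set.Ioi (0 : ℝ), 0 ≤ 2 * Real.exp (-(3 * Real.log (1 + x))) :=
    fun x _ => by positivity
  have hi := integrableOn_Ioi_deriv_of_nonneg hc hd hn ht
  rw [← ofReal_integral_eq_lintegral_ofReal hi (Filter.Eventually.of_forall fun x => by positivity),
    integral_Ioi_of_hasDerivAt_of_nonneg hc hd hn ht]
  norm_num

/-! ### From tail bounds to the Bernstein–Orlicz norm -/

section Orlicz

variable {Ω : Type*} [MeasurableSpace Ω] {μ : Measure Ω}

/-- A Bernstein-type tail bound controls the Bernstein–Orlicz functional. -/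
theorem lintegral_Psi_le_one_of_tail {Z : Ω → ℝ} (hZ : Measurable Z) {σ a : ℝ} (hσ : 0 < σ)
    (ha : 0 < a)
    (htail : ∀ t, 0 ≤ t →
      μ {ω | σ * Real.sqrt (2 * t) + a * t ≤ |Z ω|} ≤ ENNReal.ofReal (2 * Real.exp (-t))) :
    ∫⁻ ω, ENNReal.ofReal (Psi (Real.sqrt 6 * a / σ) (|Z ω| / (Real.sqrt 6 * σ))) ∂μ ≤ 1 := by
  have h6 : 0 < Real.sqrt 6 := by positivity
  have hL : 0 < Real.sqrt 6 * a / σ := by positivity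
  rw [lintegral_eq_lintegral_meas_le μ (Filter.Eventually.of_forall fun ω => Psi_nonneg _ _)
    (((measurable_Psi _).comp (hZ.abs.div_const _)).aemeasurable)]
  rw [← lintegral_Ioi_two_mul_one_add_pow]
  refine setLIntegral_mono' measurableSet_Ioi fun t ht => ?_
  have ht : 0 < t := ht
  have hs0 : 0 ≤ Real.log (1 + t) := Real.log_nonneg (by linarith)
  -- With `s = log (1 + t)`, the event `Ψ_L ≥ t` forces `|Z| ≥ √6 σ (√s + L s / 2) = σ √(2·3s) +
  -- a·3s`, which is the tail event at `3s`.
  refine (measure_mono fun ω hω => ?_).trans (htail (3 * Real.log (1 + t)) (by positivity))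
  have h := le_of_le_Psi hL (by positivity) ht.le hω
  rw [le_div_iff₀ (by positivity)] at h
  show σ * Real.sqrt (2 * (3 * Real.log (1 + t))) + a * (3 * Real.log (1 + t)) ≤ |Z ω|
  have e1 : Real.sqrt (2 * (3 * Real.log (1 + t))) = Real.sqrt 6 * Real.sqrt (Real.log (1 + t)) := by
    rw [← Real.sqrt_mul (by norm_num)]
    ring_nf
  have e2 : Real.sqrt 6 ^ 2 = 6 := Real.sq_sqrt (by norm_num)
  refine le_trans (le_of_eq ?_) h
  rw [e1]
  field_simp
  linear_combination (-(a * Real.log (1 + t))) * e2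

theorem orliczNorm_le {Ψ : ℝ → ℝ} {Z : Ω → ℝ} {c : ℝ} (hc : 0 < c)
    (h : ∫⁻ ω, ENNReal.ofReal (Ψ (|Z ω| / c)) ∂μ ≤ 1) :
    orliczNorm Ψ Z μ ≤ ENNReal.ofReal c :=
  iInf₂_le c ⟨hc, h⟩

theorem bernsteinOrliczNorm_add_le {A B : Ω → ℝ} (hA : Measurable A) (hB : Measurable B)
    {L a b : ℝ} (hL : 0 < L) (ha : 0 < a) (hb : 0 < b)
    (h1 : ∫⁻ ω, ENNReal.ofReal (Psi L (|A ω| / a)) ∂μ ≤ 1)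
    (h2 : ∫⁻ ω, ENNReal.ofReal (Psi L (|B ω| / b)) ∂μ ≤ 1) :
    bernsteinOrliczNorm L (fun ω => |A ω| + |B ω|) μ ≤ ENNReal.ofReal (a + b) := by
  refine orliczNorm_le (by positivity) ?_
  have hpt : ∀ ω, ENNReal.ofReal (Psi L (|(|A ω| + |B ω|)| / (a + b)))
      ≤ ENNReal.ofReal (a / (a + b)) * ENNReal.ofReal (Psi L (|A ω| / a))
        + ENNReal.ofReal (b / (a + b)) * ENNReal.ofReal (Psi L (|B ω| / b)) := by
    intro ω
    rw [← ENNReal.ofReal_mul (by positivity), ← ENNReal.ofReal_mul (by positivity),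
      ← ENNReal.ofReal_add (mul_nonneg (by positivity) (Psi_nonneg _ _))
        (mul_nonneg (by positivity) (Psi_nonneg _ _))]
    apply ENNReal.ofReal_le_ofReal
    have h := (Psi_convexOn hL).2 (show |A ω| / a ∈ Set.Ici (0 : ℝ) from Set.mem_Ici.2 (by positivity))
      (show |B ω| / b ∈ Set.Ici (0 : ℝ) from Set.mem_Ici.2 (by positivity))
      (show 0 ≤ a / (a + b) by positivity) (show 0 ≤ b / (a + b) by positivity) (by field_simp)
    simp only [smul_eq_mul] at h
    refine le_trans (le_of_eq ?_) h
    rw [abs_of_nonneg (by positivity)]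
    congr 1
    field_simp
  refine (lintegral_mono hpt).trans ?_
  rw [lintegral_add_left (by have := measurable_Psi L; fun_prop),
    lintegral_const_mul _ (by have := measurable_Psi L; fun_prop),
    lintegral_const_mul _ (by have := measurable_Psi L; fun_prop)]
  calc _ ≤ ENNReal.ofReal (a / (a + b)) * 1 + ENNReal.ofReal (b / (a + b)) * 1 := by gcongr
    _ = 1 := by
      rw [mul_one, mul_one, ← ENNReal.ofReal_add (by positivity) (by positivity),
        ← ENNReal.ofReal_one]
      congr 1
      field_simp

end Orlicz

/-! ### Exponential moments from absolute moments -/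

/-- For negative `x` the gap is `2 (sinh |x| - |x|) ≥ 0`. Only absolute moments are controlled,
hence the passage to `|x|`. -/
theorem exp_sub_le_exp_abs_sub (x : ℝ) : Real.exp x - 1 - x ≤ Real.exp |x| - 1 - |x| := by
  rcases le_total 0 x with h | h
  · rw [abs_of_nonneg h]
  · rw [abs_of_nonpos h]
    have := Real.self_le_sinh_iff.2 (neg_nonneg.2 h)
    rw [Real.sinh_eq, neg_neg] at this
    linarith

theorem ofReal_exp_sub_eq_tsum {y : ℝ} (hy : 0 ≤ y) :
    ENNReal.ofReal (Real.exp y - 1 - y)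
      = ∑' m : ℕ, ENNReal.ofReal (y ^ (m + 2) / ((m + 2) ! : ℝ)) := by
  have h := NormedSpace.expSeries_div_hasSum_exp (𝔸 := ℝ) y
  rw [← Real.exp_eq_exp_ℝ] at h
  have h2 := (hasSum_nat_add_iff' 2).2 h
  rw [← ENNReal.ofReal_tsum_of_nonneg (fun m => by positivity) h2.summable, h2.tsum_eq]
  simp [Finset.sum_range_succ, sub_sub]

section Mgf

variable {Ω : Type*} [MeasurableSpace Ω] {μ : Measure Ω}

theorem exp_abs_sub_nonneg (x : ℝ) : 0 ≤ Real.exp |x| - 1 - |x| := by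
  linarith [Real.add_one_le_exp |x|]

theorem integrable_exp_abs_sub {Y : Ω → ℝ} (hm : Measurable Y)
    (hR : ∫⁻ ω, ENNReal.ofReal (Real.exp |Y ω| - 1 - |Y ω|) ∂μ ≠ ⊤) :
    Integrable (fun ω => Real.exp |Y ω| - 1 - |Y ω|) μ := by
  refine ⟨by fun_prop, ?_⟩
  rw [hasFiniteIntegral_iff_ofReal (Filter.Eventually.of_forall fun ω => exp_abs_sub_nonneg _)]
  exact hR.lt_top

variable [IsProbabilityMeasure μ]

theorem integrable_exp_of_lintegral {Y : Ω → ℝ} (hm : Measurable Y) (hY : Integrable Y μ)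
    (hR : ∫⁻ ω, ENNReal.ofReal (Real.exp |Y ω| - 1 - |Y ω|) ∂μ ≠ ⊤) :
    Integrable (fun ω => Real.exp (Y ω)) μ := by
  refine Integrable.mono' (((integrable_exp_abs_sub hm hR).add hY).add (integrable_const (1 : ℝ)))
    (by fun_prop) (Filter.Eventually.of_forall fun ω => ?_)
  have := exp_sub_le_exp_abs_sub (Y ω)
  rw [Real.norm_eq_abs, Real.abs_exp]
  simp only [Pi.add_apply]
  linarith

/-- With `r` the expected remainder, `E e^Y ≤ 1 + E Y + r ≤ e^{E Y + r}`; divide by `e^{E Y}`. -/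
theorem integral_exp_sub_integral_le {Y : Ω → ℝ} (hm : Measurable Y) (hY : Integrable Y μ)
    (hR : ∫⁻ ω, ENNReal.ofReal (Real.exp |Y ω| - 1 - |Y ω|) ∂μ ≠ ⊤) :
    ∫ ω, Real.exp (Y ω - ∫ ω', Y ω' ∂μ) ∂μ
      ≤ Real.exp (∫⁻ ω, ENNReal.ofReal (Real.exp |Y ω| - 1 - |Y ω|) ∂μ).toReal := by
  have hi := integrable_exp_abs_sub hm hR
  have h1 : ∫ ω, Real.exp (Y ω) ∂μ
      ≤ 1 + ∫ ω, Y ω ∂μ + ∫ ω, (Real.exp |Y ω| - 1 - |Y ω|) ∂μ := by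
    have : ∫ ω, (1 + Y ω + (Real.exp |Y ω| - 1 - |Y ω|)) ∂μ
        = 1 + ∫ ω, Y ω ∂μ + ∫ ω, (Real.exp |Y ω| - 1 - |Y ω|) ∂μ := by
      rw [integral_add (by fun_prop) hi, integral_add (integrable_const _) hY]
      simp
    rw [← this]
    refine integral_mono (integrable_exp_of_lintegral hm hY hR)
      (((integrable_const _).add hY).add hi) fun ω => ?_
    have := exp_sub_le_exp_abs_sub (Y ω)
    simp only
    linarith
  rw [integral_eq_lintegral_of_nonneg_ae
    (Filter.Eventually.of_forall fun ω => exp_abs_sub_nonneg (Y ω)) hi.1] at h1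
  set r := (∫⁻ ω, ENNReal.ofReal (Real.exp |Y ω| - 1 - |Y ω|) ∂μ).toReal
  simp_rw [Real.exp_sub]
  rw [integral_div, div_le_iff₀ (Real.exp_pos _), ← Real.exp_add]
  linarith [Real.add_one_le_exp (r + ∫ ω, Y ω ∂μ)]

end Mgf

/-! ### Bernstein's inequality for the empirical process -/

section EmpiricalBernstein

variable {Ω 𝓧 : Type*} [MeasurableSpace Ω] {n : ℕ} {μ : Measure Ω} {X : Fin n → Ω → 𝓧}

/-- Bernstein's moment condition with variance factor `σ²` and scale `b`. -/
def BernsteinCondition (μ : Measure Ω) (X : Fin n → Ω → 𝓧) (h : 𝓧 → ℝ) (σ b : ℝ) : Prop :=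
  ∀ m : ℕ, absMoment μ X (m + 2) h ≤ ENNReal.ofReal (((m + 2) ! : ℝ) / 2 * σ ^ 2 * b ^ m)

theorem sum_lintegral_eq_mul_absMoment (hn : 1 ≤ n) (m : ℕ) (h : 𝓧 → ℝ) :
    ∑ i, ∫⁻ ω, ENNReal.ofReal (|h (X i ω)| ^ m) ∂μ = n * absMoment μ X m h := by
  unfold absMoment
  rw [ENNReal.mul_div_cancel (by simp; omega) (by simp)]

theorem BernsteinCondition.absMoment_two_ne_top {h : 𝓧 → ℝ} {σ b : ℝ}
    (hB : BernsteinCondition μ X h σ b) : absMoment μ X 2 h ≠ ⊤ :=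
  ((hB 0).trans_lt ENNReal.ofReal_lt_top).ne

theorem BernsteinCondition.neg {h : 𝓧 → ℝ} {σ b : ℝ}
    (hB : BernsteinCondition μ X h σ b) : BernsteinCondition μ X (-h) σ b := by
  intro m
  simpa [absMoment] using hB m

theorem empiricalProcess_neg (h : 𝓧 → ℝ) (ω : Ω) :
    empiricalProcess μ X (-h) ω = -(empiricalProcess μ X h ω) := by
  simp only [empiricalProcess, Pi.neg_apply, Finset.sum_neg_distrib, integral_neg]
  ring

theorem empiricalProcess_eq (hn : 1 ≤ n) (h : 𝓧 → ℝ) (ω : Ω) :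
    empiricalProcess μ X h ω
      = (Real.sqrt n)⁻¹ * ∑ i, (h (X i ω) - ∫ ω', h (X i ω') ∂μ) := by
  have hn' : (0 : ℝ) < n := by exact_mod_cast hn
  have h2 : Real.sqrt n ^ 2 = n := Real.sq_sqrt hn'.le
  rw [empiricalProcess, Finset.sum_sub_distrib, ← mul_sub, ← mul_assoc]
  congr 1
  have := Real.sqrt_pos.2 hn'
  field_simp
  exact h2

variable [MeasurableSpace 𝓧]

theorem integrable_sq_comp (hX : ∀ i, Measurable (X i)) {h : 𝓧 → ℝ}
    (hm : Measurable h) (hfin : absMoment μ X 2 h ≠ ⊤) (hn : 1 ≤ n) (i : Fin n) :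
    Integrable (fun ω => h (X i ω) ^ 2) μ := by
  refine ⟨((hm.comp (hX i)).pow_const 2).aestronglyMeasurable, ?_⟩
  rw [hasFiniteIntegral_iff_ofReal (Filter.Eventually.of_forall fun ω => sq_nonneg _)]
  simp_rw [← sq_abs (h (X i _))]
  refine lt_of_le_of_lt (Finset.single_le_sum (f := fun i =>
    ∫⁻ ω, ENNReal.ofReal (|h (X i ω)| ^ 2) ∂μ) (fun _ _ => zero_le) (Finset.mem_univ i)) ?_
  rw [sum_lintegral_eq_mul_absMoment hn]
  exact ENNReal.mul_lt_top (by simp) hfin.lt_top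

theorem integrable_comp [IsProbabilityMeasure μ] (hX : ∀ i, Measurable (X i)) {h : 𝓧 → ℝ}
    (hm : Measurable h) (hfin : absMoment μ X 2 h ≠ ⊤) (hn : 1 ≤ n) (i : Fin n) :
    Integrable (fun ω => h (X i ω)) μ :=
  ((memLp_two_iff_integrable_sq (hm.comp (hX i)).aestronglyMeasurable).2
    (integrable_sq_comp hX hm hfin hn i)).integrable (by norm_num)

/-- Expanding the exponential in powers cancels the factorials of the moment condition and leaves a
geometric series of ratio `r b`. The sum over `i` is taken first because the condition bounds only
averages over `i`. -/
theorem sum_lintegral_exp_le (hX : ∀ i, Measurable (X i)) {h : 𝓧 → ℝ}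
    (hm : Measurable h) (hn : 1 ≤ n) {σ b r : ℝ} (hb : 0 ≤ b) (hr : 0 ≤ r)
    (hrb : r * b < 1) (hB : BernsteinCondition μ X h σ b) :
    ∑ i, ∫⁻ ω, ENNReal.ofReal (Real.exp |r * h (X i ω)| - 1 - |r * h (X i ω)|) ∂μ
      ≤ ENNReal.ofReal (n * σ ^ 2 * r ^ 2 / (2 * (1 - r * b))) := by
  have e1 : ∀ i, ∫⁻ ω, ENNReal.ofReal (Real.exp |r * h (X i ω)| - 1 - |r * h (X i ω)|) ∂μ
      = ∑' m : ℕ, ENNReal.ofReal (r ^ (m + 2) / ((m + 2) ! : ℝ))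
        * ∫⁻ ω, ENNReal.ofReal (|h (X i ω)| ^ (m + 2)) ∂μ := by
    intro i
    have hmi := hm.comp (hX i)
    simp_rw [ofReal_exp_sub_eq_tsum (abs_nonneg _)]
    rw [lintegral_tsum (fun m => by
      have : Measurable fun ω => h (X i ω) := hmi
      fun_prop)]
    congr 1
    ext m
    rw [← lintegral_const_mul _ (by
      have : Measurable fun ω => h (X i ω) := hmi
      fun_prop)]
    congr 1
    ext ω
    rw [← ENNReal.ofReal_mul (by positivity), abs_mul, abs_of_nonneg hr, mul_pow]
    congr 1
    ring
  simp_rw [e1]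
  rw [← Summable.tsum_finsetSum (fun _ _ => ENNReal.summable)]
  simp_rw [← Finset.mul_sum, sum_lintegral_eq_mul_absMoment hn]
  have hg := hasSum_geometric_of_lt_one (mul_nonneg hr hb) hrb
  have hg2 := hg.mul_left (n * σ ^ 2 * r ^ 2 / 2)
  have e2 : n * σ ^ 2 * r ^ 2 / (2 * (1 - r * b)) = n * σ ^ 2 * r ^ 2 / 2 * (1 - r * b)⁻¹ := by
    rw [← div_div, div_eq_mul_inv _ (1 - r * b)]
  rw [e2, ← hg2.tsum_eq, ENNReal.ofReal_tsum_of_nonneg (fun m => by positivity) hg2.summable]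
  refine ENNReal.tsum_le_tsum fun m => ?_
  calc ENNReal.ofReal (r ^ (m + 2) / ((m + 2) ! : ℝ)) * (n * absMoment μ X (m + 2) h)
      ≤ ENNReal.ofReal (r ^ (m + 2) / ((m + 2) ! : ℝ)) * (n *
          ENNReal.ofReal (((m + 2) ! : ℝ) / 2 * σ ^ 2 * b ^ m)) := by gcongr; exact hB m
    _ = _ := by
      rw [← ENNReal.ofReal_natCast n, ← ENNReal.ofReal_mul (by positivity),
        ← ENNReal.ofReal_mul (by positivity)]
      congr 1
      have : ((m + 2) ! : ℝ) ≠ 0 := by positivity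
      field_simp
      ring

theorem measurable_empiricalProcess (hX : ∀ i, Measurable (X i)) {h : 𝓧 → ℝ}
    (hm : Measurable h) : Measurable (empiricalProcess μ X h) := by
  unfold empiricalProcess
  have : ∀ i, Measurable fun ω => h (X i ω) := fun i => hm.comp (hX i)
  fun_prop

variable [IsProbabilityMeasure μ]

/-- Independence turns the moment generating function into a product. Each factor is at most the
exponential of its own remainder, and only the sum of the remainders has to be bounded. -/
theorem integral_exp_sum_le (hX : ∀ i, Measurable (X i)) (hind : iIndepFun X μ) {h : 𝓧 → ℝ}
    (hm : Measurable h) (hn : 1 ≤ n) {σ b r : ℝ} (hb : 0 ≤ b) (hr : 0 ≤ r)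
    (hrb : r * b < 1) (hB : BernsteinCondition μ X h σ b) :
    Integrable (fun ω => Real.exp (r * (∑ i, fun ω => h (X i ω) - ∫ ω', h (X i ω') ∂μ) ω)) μ ∧
    mgf (∑ i, fun ω => h (X i ω) - ∫ ω', h (X i ω') ∂μ) μ r
      ≤ Real.exp (n * σ ^ 2 * r ^ 2 / (2 * (1 - r * b))) := by
  have hmi : ∀ i, Measurable fun ω => h (X i ω) := fun i => hm.comp (hX i)
  have hint := integrable_comp hX hm hB.absMoment_two_ne_top hn
  have hsum := sum_lintegral_exp_le hX hm hn hb hr hrb hB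
  have hfin : ∀ i, ∫⁻ ω, ENNReal.ofReal (Real.exp |r * h (X i ω)| - 1 - |r * h (X i ω)|) ∂μ ≠ ⊤ :=
    fun i => (((Finset.single_le_sum (f := fun i =>
      ∫⁻ ω, ENNReal.ofReal (Real.exp |r * h (X i ω)| - 1 - |r * h (X i ω)|) ∂μ)
      (fun _ _ => zero_le) (Finset.mem_univ i)).trans hsum).trans_lt ENNReal.ofReal_lt_top).ne
  have hind' : iIndepFun (fun i ω => h (X i ω) - ∫ ω', h (X i ω') ∂μ) μ :=
    hind.comp (fun i x => h x - ∫ ω', h (X i ω') ∂μ) (fun i => hm.sub_const _)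
  have hexp : ∀ i, Integrable (fun ω => Real.exp (r * (h (X i ω) - ∫ ω', h (X i ω') ∂μ))) μ := by
    intro i
    have := (integrable_exp_of_lintegral ((hmi i).const_mul r) ((hint i).const_mul r)
      (hfin i)).div_const (Real.exp (r * ∫ ω', h (X i ω') ∂μ))
    simpa only [mul_sub, Real.exp_sub] using this
  refine ⟨hind'.integrable_exp_mul_sum (fun i => (hmi i).sub_const _) fun i _ => hexp i, ?_⟩
  rw [hind'.mgf_sum (fun i => (hmi i).sub_const _)]
  have hD : 0 ≤ n * σ ^ 2 * r ^ 2 / (2 * (1 - r * b)) :=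
    div_nonneg (by positivity) (by linarith)
  calc _ ≤ ∏ i, Real.exp (∫⁻ ω,
        ENNReal.ofReal (Real.exp |r * h (X i ω)| - 1 - |r * h (X i ω)|) ∂μ).toReal := by
        refine Finset.prod_le_prod (fun i _ => mgf_nonneg) fun i _ => ?_
        have := integral_exp_sub_integral_le ((hmi i).const_mul r) ((hint i).const_mul r) (hfin i)
        rw [integral_const_mul] at this
        simpa only [mgf, mul_sub] using this
    _ ≤ _ := by
        rw [← Real.exp_sum, ← ENNReal.toReal_sum fun i _ => hfin i]
        exact Real.exp_le_exp.2 (ENNReal.toReal_le_of_le_ofReal hD hsum)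

theorem measure_empiricalProcess_ge_le (hX : ∀ i, Measurable (X i)) (hind : iIndepFun X μ)
    {h : 𝓧 → ℝ} (hm : Measurable h) (hn : 1 ≤ n) {σ b t : ℝ} (hσ : 0 < σ) (hb : 0 < b)
    (ht : 0 ≤ t) (hB : BernsteinCondition μ X h σ b) :
    μ {ω | σ * Real.sqrt (2 * t) + b / Real.sqrt n * t ≤ empiricalProcess μ X h ω}
      ≤ ENNReal.ofReal (Real.exp (-t)) := by
  have hn' : (0 : ℝ) < n := by exact_mod_cast hn
  have hsn := Real.sqrt_pos.2 hn'
  have hsq : Real.sqrt n ^ 2 = n := Real.sq_sqrt hn'.le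
  set q := Real.sqrt (2 * t) with hq
  have hq0 : 0 ≤ q := Real.sqrt_nonneg _
  have hq2 : q ^ 2 = 2 * t := Real.sq_sqrt (by positivity)
  set N := Real.sqrt n with hN
  -- With this Chernoff parameter `1 - r b = σN / (σN + bq)`, and the exponent `-r(σNq + bt) + nσ²r²
  -- / (2(1 - rb))` equals exactly `-q²/2 = -t`.
  set r := q / (σ * N + b * q) with hr
  have hden : 0 < σ * N + b * q := by positivity
  have hr0 : 0 ≤ r := by positivity
  have h1 : 1 - r * b = σ * N / (σ * N + b * q) := by rw [hr]; field_simp; ring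
  have hrb : r * b < 1 := by
    have : 0 < σ * N / (σ * N + b * q) := by positivity
    linarith
  obtain ⟨hi, hmgf⟩ := integral_exp_sum_le hX hind hm hn hb.le hr0 hrb hB
  have hch := measure_ge_le_exp_mul_mgf (σ * N * q + b * t) hr0 hi
  have hset : {ω | σ * q + b / N * t ≤ empiricalProcess μ X h ω} ⊆
      {ω | σ * N * q + b * t ≤ (∑ i, fun ω => h (X i ω) - ∫ ω', h (X i ω') ∂μ) ω} := by
    intro ω hω
    simp only [Set.mem_ofPred_eq, Finset.sum_apply] at hω ⊢
    rw [empiricalProcess_eq hn, ← hN, inv_mul_eq_div, le_div_iff₀ hsn] at hω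
    refine le_trans (le_of_eq ?_) hω
    field_simp
  refine (measure_mono hset).trans ?_
  rw [← ENNReal.ofReal_toReal (measure_ne_top μ _)]
  apply ENNReal.ofReal_le_ofReal
  refine hch.trans ((mul_le_mul_of_nonneg_left hmgf (Real.exp_pos _).le).trans ?_)
  rw [← Real.exp_add, h1]
  apply Real.exp_le_exp.2
  apply le_of_eq
  rw [hr, ← hsq]
  have ht2 : t = q ^ 2 / 2 := by linarith
  rw [ht2]
  field_simp
  ring

/-- Bernstein's inequality for the empirical process, in Bernstein–Orlicz form. -/
theorem lintegral_Psi_empiricalProcess_le_one (hX : ∀ i, Measurable (X i))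
    (hind : iIndepFun X μ) {h : 𝓧 → ℝ} (hm : Measurable h) (hn : 1 ≤ n) {σ b L : ℝ}
    (hσ : 0 < σ) (hb : 0 < b) (hB : BernsteinCondition μ X h σ b)
    (hL : L = Real.sqrt 6 * (b / Real.sqrt n) / σ) :
    ∫⁻ ω, ENNReal.ofReal (Psi L (|(empiricalProcess μ X h ω)| / (Real.sqrt 6 * σ))) ∂μ ≤ 1 := by
  have hn' : (0 : ℝ) < n := by exact_mod_cast hn
  have hsn := Real.sqrt_pos.2 hn'
  rw [hL]
  refine lintegral_Psi_le_one_of_tail (measurable_empiricalProcess hX hm) hσ (by positivity)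
    fun t ht => ?_
  have h1 := measure_empiricalProcess_ge_le hX hind hm hn hσ hb ht hB
  have h2 := measure_empiricalProcess_ge_le hX hind hm.neg hn hσ hb ht hB.neg
  rw [two_mul (Real.exp (-t)), ENNReal.ofReal_add (Real.exp_pos _).le (Real.exp_pos _).le]
  refine (measure_mono fun ω hω => ?_).trans ((measure_union_le _ _).trans (add_le_add h1 h2))
  rw [Set.mem_ofPred_eq] at hω
  rcases le_abs.1 hω with h | h
  · exact Or.inl h
  · exact Or.inr (by simpa only [Set.mem_ofPred_eq, empiricalProcess_neg] using h)

end EmpiricalBernstein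

/-! ### The tree of bracket index sequences -/

section Tree

/-- The forest of all truncations of index sequences with `k`-th entry in `Fin (N k)`, labelled by
a family that depends on a parameter only through the corresponding truncation. -/
theorem exists_finiteTree_of_choice {Ω Θ : Type*} (S : ℕ) (N : ℕ → ℕ) (c : Θ → ∀ k, Fin (N k))
    (V : ℕ → Θ → Ω → ℝ)
    (hV : ∀ s θ θ', (∀ k ≤ s, c θ k = c θ' k) → V s θ = V s θ') :
    ∃ (T : FiniteTree S) (W : Fin T.N → Ω → ℝ),
      (∀ s, (T.gen s).card = ∏ k ∈ Finset.range ((s : ℕ) + 1), N k) ∧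
      (∀ s, ∀ j ∈ T.gen s, W j = 0 ∨ ∃ θ, W j = V s θ) ∧
      ∀ θ, ∃ b, T.IsBranch b ∧ ∀ s, W (b s) = V s θ := by
  classical
  let A : Type := Σ s : Fin (S + 1), (∀ k : Fin ((s : ℕ) + 1), Fin (N k))
  obtain ⟨m, ⟨e⟩⟩ : ∃ m, Nonempty (A ≃ Fin m) := ⟨_, ⟨Fintype.equivFin A⟩⟩
  -- The parent drops the last entry; natural subtraction keeps generation 0 in place.
  let par : A → A := fun a =>
    ⟨⟨a.1 - 1, by omega⟩, fun k => a.2 ⟨k, by have := k.2; simp only at this; omega⟩⟩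
  -- Any parameter with this truncation serves, since `hV` makes the label independent of the
  -- choice. Sequences attained by no parameter get the label 0.
  let lab : A → Ω → ℝ := fun a =>
    if h : ∃ θ, ∀ k : Fin ((a.1 : ℕ) + 1), c θ k = a.2 k then V a.1 h.choose else 0
  let node : Θ → Fin (S + 1) → A := fun θ s => ⟨s, fun k => c θ k⟩
  let T : FiniteTree S :=
    { N := m
      gen := fun s => Finset.univ.filter fun j => (e.symm j).1 = s
      disjoint := fun s t hst => by
        rw [Finset.disjoint_filter]
        intro j _ h1 h2
        exact hst (h1.symm.trans h2)
      cover := fun j => ⟨(e.symm j).1, Finset.mem_filter.2 ⟨Finset.mem_univ _, rfl⟩⟩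
      parent := fun j => e (par (e.symm j))
      parent_mem := fun s j hj => by
        simp only [Finset.mem_filter, Finset.mem_univ, true_and, Equiv.symm_apply_apply] at hj ⊢
        ext
        simp [par, hj] }
  have hlab : ∀ θ s, lab (node θ s) = V s θ := by
    intro θ s
    have h : ∃ θ', ∀ k : Fin ((s : ℕ) + 1), c θ' k = (node θ s).2 k := ⟨θ, fun _ => rfl⟩
    simp only [lab]
    rw [dif_pos h]
    exact hV s _ _ fun k hk => h.choose_spec ⟨k, Nat.lt_succ_of_le hk⟩
  refine ⟨T, fun j => lab (e.symm j), fun s => ?_, fun s j hj => ?_, fun θ => ?_⟩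
  · have h1 : (T.gen s).card = Fintype.card (∀ k : Fin ((s : ℕ) + 1), Fin (N k)) := by
      rw [← Finset.card_univ]
      symm
      refine Finset.card_bij (fun a _ => e ⟨s, a⟩) (fun a _ => Finset.mem_filter.2
        ⟨Finset.mem_univ _, congrArg Sigma.fst (e.symm_apply_apply ⟨s, a⟩)⟩) ?_ ?_
      · intro a _ a' _ h
        have h := e.injective h
        cases h
        rfl
      · intro j hj
        simp only [T, Finset.mem_filter, Finset.mem_univ, true_and] at hj
        obtain ⟨⟨s', a⟩, rfl⟩ := e.surjective j
        simp only [Equiv.symm_apply_apply] at hj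
        subst hj
        exact ⟨a, Finset.mem_univ _, rfl⟩
    rw [h1, Fintype.card_pi]
    simp only [Fintype.card_fin]
    exact Fin.prod_univ_eq_prod_range N (s + 1)
  · simp only [T, Finset.mem_filter, Finset.mem_univ, true_and] at hj
    simp only [lab]
    split_ifs with h
    · exact Or.inr ⟨h.choose, congrArg (fun r : Fin (S + 1) => V r h.choose) hj⟩
    · exact Or.inl rfl
  · refine ⟨fun s => e (node θ s), ⟨Finset.mem_filter.2 ⟨Finset.mem_univ _,
      congrArg Sigma.fst (e.symm_apply_apply (node θ (Fin.last S)))⟩, fun s => ?_⟩, fun s => ?_⟩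
    · simp only [T, Equiv.symm_apply_apply]
      rfl
    · simp only [Equiv.symm_apply_apply]
      exact hlab θ s

end Tree

/-! ### Moment conditions, means and biases -/

section Moments

variable {Ω 𝓧 : Type*} [MeasurableSpace Ω] {n : ℕ} {μ : Measure Ω} {X : Fin n → Ω → 𝓧}

theorem absMoment_mono {f h : 𝓧 → ℝ} (m : ℕ) (hfh : ∀ x, |f x| ≤ |h x|) :
    absMoment μ X m f ≤ absMoment μ X m h := by
  unfold absMoment
  refine ENNReal.div_le_div_right (Finset.sum_le_sum fun i _ => lintegral_mono fun ω =>
    ENNReal.ofReal_le_ofReal (pow_le_pow_left₀ (abs_nonneg _) (hfh _) m)) _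

theorem BernsteinCondition.mono {f h : 𝓧 → ℝ} {σ b b' : ℝ} (hB : BernsteinCondition μ X h σ b)
    (hb : 0 ≤ b) (hbb : b ≤ b') (hfh : ∀ x, |f x| ≤ |h x|) : BernsteinCondition μ X f σ b' := by
  intro m
  refine (absMoment_mono (m + 2) hfh).trans ((hB m).trans ?_)
  gcongr

theorem three_pow_le_factorial (m : ℕ) : (3 : ℝ) ^ m ≤ ((m + 2) ! : ℝ) / 2 := by
  induction m with
  | zero => norm_num
  | succ m ih =>
    rw [show m + 1 + 2 = (m + 2) + 1 by ring, Nat.factorial_succ, pow_succ]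
    push_cast
    have : (0 : ℝ) ≤ m := by positivity
    nlinarith [pow_pos (show (0 : ℝ) < 3 by norm_num) m]

/-- Since `|h|^{m+2} ≤ c^m h²` and `3^m ≤ (m+2)!/2`, a bound `c` permits the scale `c/3` or anything
larger. -/
theorem BernsteinCondition.of_bounded {h : 𝓧 → ℝ} {σ b c : ℝ} (hc : 0 ≤ c)
    (hcb : c ≤ 3 * b) (hbd : ∀ x, |h x| ≤ c)
    (h2 : absMoment μ X 2 h ≤ ENNReal.ofReal (σ ^ 2)) : BernsteinCondition μ X h σ b := by
  intro m
  have hb : 0 ≤ b := by linarith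
  have h1 : absMoment μ X (m + 2) h ≤ ENNReal.ofReal (c ^ m) * absMoment μ X 2 h := by
    unfold absMoment
    rw [← mul_div_assoc, Finset.mul_sum]
    gcongr with i
    rw [← lintegral_const_mul' _ _ ENNReal.ofReal_ne_top]
    refine lintegral_mono fun ω => ?_
    rw [← ENNReal.ofReal_mul (by positivity), pow_add]
    have := hbd (X i ω)
    gcongr
  refine h1.trans ?_
  calc ENNReal.ofReal (c ^ m) * absMoment μ X 2 h
      ≤ ENNReal.ofReal (c ^ m) * ENNReal.ofReal (σ ^ 2) := by gcongr
    _ = ENNReal.ofReal (c ^ m * σ ^ 2) := (ENNReal.ofReal_mul (by positivity)).symm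
    _ ≤ _ := by
      apply ENNReal.ofReal_le_ofReal
      have h3 : c ^ m ≤ ((m + 2) ! : ℝ) / 2 * b ^ m := by
        calc c ^ m ≤ (3 * b) ^ m := by gcongr
          _ = 3 ^ m * b ^ m := mul_pow _ _ _
          _ ≤ _ := by gcongr; exact three_pow_le_factorial m
      nlinarith [mul_le_mul_of_nonneg_right h3 (sq_nonneg σ)]

theorem absMoment_two_le_of_avgNorm_le {h : 𝓧 → ℝ} {ε : ℝ} (hε : 0 ≤ ε)
    (hh : avgNorm μ X h ≤ ENNReal.ofReal ε) : absMoment μ X 2 h ≤ ENNReal.ofReal (ε ^ 2) := by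
  have h1 : (avgNorm μ X h) ^ (2 : ℝ) = absMoment μ X 2 h := by
    rw [avgNorm, ← ENNReal.rpow_mul]
    norm_num
  rw [← h1, ENNReal.ofReal_pow hε, ENNReal.rpow_two]
  gcongr

/-- The mean `P h = (1/n) ∑ᵢ E h(Xᵢ)`. -/
noncomputable def avgMean (μ : Measure Ω) (X : Fin n → Ω → 𝓧) (h : 𝓧 → ℝ) : ℝ :=
  (1 / n) * ∑ i, ∫ ω, h (X i ω) ∂μ

theorem empiricalProcess_add {f h : 𝓧 → ℝ} (hf : ∀ i, Integrable (fun ω => f (X i ω)) μ)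
    (hh : ∀ i, Integrable (fun ω => h (X i ω)) μ) (ω : Ω) :
    empiricalProcess μ X (f + h) ω = empiricalProcess μ X f ω + empiricalProcess μ X h ω := by
  unfold empiricalProcess
  simp only [Pi.add_apply]
  simp_rw [fun i => integral_add (hf i) (hh i)]
  rw [Finset.sum_add_distrib, Finset.sum_add_distrib]
  ring

/-- By positivity, the empirical mean of `f` minus its true mean lies between minus the true mean of
`w` and the empirical mean of `w`. No control of `w - f` is needed. -/
theorem abs_empiricalProcess_le_of_le {f w : 𝓧 → ℝ}
    (hf : ∀ i, Integrable (fun ω => f (X i ω)) μ)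
    (hw : ∀ i, Integrable (fun ω => w (X i ω)) μ) (h0 : ∀ x, 0 ≤ f x) (hfw : ∀ x, f x ≤ w x)
    (ω : Ω) :
    |(empiricalProcess μ X f ω)|
      ≤ |(empiricalProcess μ X w ω)| + Real.sqrt n * avgMean μ X w := by
  have a1 : 0 ≤ ∑ i, f (X i ω) := Finset.sum_nonneg fun i _ => h0 _
  have a2 : ∑ i, f (X i ω) ≤ ∑ i, w (X i ω) := Finset.sum_le_sum fun i _ => hfw _
  have b1 : 0 ≤ ∑ i, ∫ ω', f (X i ω') ∂μ := Finset.sum_nonneg fun i _ => integral_nonneg fun _ => h0 _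
  have b2 : ∑ i, ∫ ω', f (X i ω') ∂μ ≤ ∑ i, ∫ ω', w (X i ω') ∂μ :=
    Finset.sum_le_sum fun i _ => integral_mono (hf i) (hw i) fun _ => hfw _
  have key : ∀ c : ℝ, 0 ≤ c → ∀ p q P Q : ℝ, 0 ≤ p → p ≤ P → 0 ≤ q → q ≤ Q →
      |c * (p - q)| ≤ |c * (P - Q)| + c * Q := by
    intro c hc p q P Q hp hP hq hQ
    have e1 := le_abs_self (c * (P - Q))
    have e2 := abs_nonneg (c * (P - Q))
    rw [abs_le]
    constructor
    · nlinarith [mul_nonneg hc hp, mul_le_mul_of_nonneg_left hQ hc]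
    · nlinarith [mul_nonneg hc hq, mul_le_mul_of_nonneg_left hP hc]
  have hn : (0 : ℝ) ≤ 1 / n := by positivity
  exact key _ (Real.sqrt_nonneg _) _ _ _ _ (mul_nonneg hn a1) (mul_le_mul_of_nonneg_left a2 hn)
    (mul_nonneg hn b1) (mul_le_mul_of_nonneg_left b2 hn)

variable [MeasurableSpace 𝓧]

theorem avgMean_sq_le (hX : ∀ i, Measurable (X i)) {h : 𝓧 → ℝ} (hm : Measurable h)
    {v : ℝ} (hv : 0 ≤ v) (h2 : absMoment μ X 2 h ≤ ENNReal.ofReal v) :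
    avgMean μ X (fun x => h x ^ 2) ≤ v := by
  have e : absMoment μ X 2 h = (∑ i, ∫⁻ ω, ENNReal.ofReal (h (X i ω) ^ 2) ∂μ) / n := by
    simp only [absMoment, sq_abs]
  have h3 := ENNReal.toReal_le_of_le_ofReal hv h2
  have h4 : avgMean μ X (fun x => h x ^ 2) = (absMoment μ X 2 h).toReal := by
    rcases Nat.eq_zero_or_pos n with rfl | hn
    · simp [avgMean, absMoment]
    rw [avgMean, e, ENNReal.toReal_div, ENNReal.toReal_natCast, one_div, inv_mul_eq_div,
      ENNReal.toReal_sum]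
    · congr 1
      refine Finset.sum_congr rfl fun i _ => ?_
      rw [integral_eq_lintegral_of_nonneg_ae (Filter.Eventually.of_forall fun ω => sq_nonneg _)
        (show Measurable fun ω => h (X i ω) ^ 2 from
          (hm.comp (hX i)).pow_const 2).aestronglyMeasurable]
    · intro i _
      refine ne_of_lt ?_
      have := (integrable_sq_comp hX hm (h2.trans_lt ENNReal.ofReal_lt_top).ne hn i).2
      rwa [hasFiniteIntegral_iff_ofReal (Filter.Eventually.of_forall fun ω => sq_nonneg _)] at this
  rw [h4]
  exact h3

/-- Both biases come from a pointwise quadratic majorant: `w²/κ` on points stopped early, and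
`w²/(2ε) + ε/2` at the last generation, in place of Cauchy–Schwarz. -/
theorem avgMean_le_of_le_sq [IsProbabilityMeasure μ] (hX : ∀ i, Measurable (X i)) (hn : 1 ≤ n)
    {f h : 𝓧 → ℝ} (hf : ∀ i, Integrable (fun ω => f (X i ω)) μ) (hm : Measurable h)
    {v a c : ℝ} (hv : 0 ≤ v) (ha : 0 ≤ a) (h2 : absMoment μ X 2 h ≤ ENNReal.ofReal v)
    (hfh : ∀ x, f x ≤ a * h x ^ 2 + c) : avgMean μ X f ≤ a * v + c := by
  have hsq := integrable_sq_comp hX hm (h2.trans_lt ENNReal.ofReal_lt_top).ne hn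
  have h1 : ∀ i, ∫ ω, f (X i ω) ∂μ ≤ a * ∫ ω, h (X i ω) ^ 2 ∂μ + c := by
    intro i
    have := integral_mono (hf i) (((hsq i).const_mul a).add (integrable_const c))
      fun ω => hfh (X i ω)
    refine this.trans (le_of_eq ?_)
    simp only [Pi.add_apply]
    rw [integral_add ((hsq i).const_mul a) (integrable_const c), integral_const_mul]
    simp
  have h3 := avgMean_sq_le hX hm hv h2
  have hn' : (n : ℝ) ≠ 0 := by positivity
  calc avgMean μ X f ≤ (1 / n) * ∑ i : Fin n, (a * ∫ ω, h (X i ω) ^ 2 ∂μ + c) := by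
        unfold avgMean
        gcongr with i
        exact h1 i
    _ = a * avgMean μ X (fun x => h x ^ 2) + c := by
        rw [Finset.sum_add_distrib, ← Finset.mul_sum, avgMean]
        simp only [Finset.sum_const, Finset.card_univ, Fintype.card_fin, nsmul_eq_mul]
        field_simp
    _ ≤ _ := by gcongr

theorem absMoment_add_le (hX : ∀ i, Measurable (X i)) {f h : 𝓧 → ℝ} (hf : Measurable f) (m : ℕ) :
    absMoment μ X m (f + h)
      ≤ ENNReal.ofReal (2 ^ (m - 1)) * (absMoment μ X m f + absMoment μ X m h) := by
  unfold absMoment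
  rw [← ENNReal.add_div, ← mul_div_assoc, ← Finset.sum_add_distrib, Finset.mul_sum]
  gcongr with i
  have hfi : Measurable fun ω => f (X i ω) := hf.comp (hX i)
  rw [← lintegral_add_left (by fun_prop), ← lintegral_const_mul' _ _ ENNReal.ofReal_ne_top]
  refine lintegral_mono fun ω => ?_
  rw [← ENNReal.ofReal_add (by positivity) (by positivity), ← ENNReal.ofReal_mul (by positivity)]
  apply ENNReal.ofReal_le_ofReal
  refine le_trans ?_ (add_pow_le (abs_nonneg _) (abs_nonneg _) m)
  gcongr
  exact abs_add_le _ _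

/-- This is meant for `l_0 = g - (g - l_0)`, as the lower bracket has no moment bound of its own. By
convexity the factor is `2^{m+1}(K^m + (2K)^m) ≤ 4 (8K)^m`. The scale `8K` is generous and gives the
ratio `8K/2 = 4K` found in `L_0`. -/
theorem BernsteinCondition.sub (hX : ∀ i, Measurable (X i)) {g w : 𝓧 → ℝ} (hg : Measurable g)
    {K : ℝ} (hK : 0 ≤ K) (h1 : BernsteinCondition μ X g 1 K)
    (h2 : BernsteinCondition μ X w 1 (2 * K)) : BernsteinCondition μ X (g - w) 2 (8 * K) := by
  intro m
  rw [sub_eq_add_neg]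
  refine (absMoment_add_le hX hg (m + 2)).trans ?_
  calc _ ≤ ENNReal.ofReal (2 ^ (m + 2 - 1)) *
        (ENNReal.ofReal (((m + 2) ! : ℝ) / 2 * 1 ^ 2 * K ^ m)
          + ENNReal.ofReal (((m + 2) ! : ℝ) / 2 * 1 ^ 2 * (2 * K) ^ m)) := by
        gcongr
        · exact h1 m
        · exact h2.neg m
    _ ≤ _ := by
        rw [← ENNReal.ofReal_add (by positivity) (by positivity),
          ← ENNReal.ofReal_mul (by positivity)]
        apply ENNReal.ofReal_le_ofReal
        have e1 : K ^ m ≤ (4 * K) ^ m := by gcongr; linarith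
        have e2 : (2 * K) ^ m ≤ (4 * K) ^ m := by gcongr; linarith
        have e3 : (8 * K) ^ m = 2 ^ m * (4 * K) ^ m := by rw [← mul_pow]; ring_nf
        rw [e3, show m + 2 - 1 = m + 1 by omega, pow_succ]
        have hF : (0 : ℝ) ≤ ((m + 2) ! : ℝ) / 2 * (2 ^ m * 2) := by positivity
        nlinarith [mul_le_mul_of_nonneg_left (add_le_add e1 e2) hF]

end Moments

/-! ### Envelopes of nested brackets and adaptive truncation -/

section Envelopes

variable {𝓧 : Type*}

/-- The running maximum `l₀ ∨ ⋯ ∨ l_s` of lower brackets. -/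
noncomputable def lowerEnvelope (l : ℕ → 𝓧 → ℝ) : ℕ → 𝓧 → ℝ
  | 0 => l 0
  | s + 1 => fun x => max (lowerEnvelope l s x) (l (s + 1) x)

/-- The running minimum `u₀ ∧ ⋯ ∧ u_s` of upper brackets. -/
noncomputable def upperEnvelope (u : ℕ → 𝓧 → ℝ) : ℕ → 𝓧 → ℝ
  | 0 => u 0
  | s + 1 => fun x => min (upperEnvelope u s x) (u (s + 1) x)

/-- The width of the intersection of the first `s + 1` brackets. -/
noncomputable def width (l u : ℕ → 𝓧 → ℝ) (s : ℕ) (x : 𝓧) : ℝ :=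
  upperEnvelope u s x - lowerEnvelope l s x

/-- The points at which the first `s` widths do not exceed their truncation levels. -/
def alive (κ : ℕ → ℝ) (l u : ℕ → 𝓧 → ℝ) (s : ℕ) : Set 𝓧 :=
  {x | ∀ k < s, width l u k x ≤ κ k}

/-- The points at which chaining to depth `S` is stopped at generation `s`. -/
def stopped (κ : ℕ → ℝ) (l u : ℕ → 𝓧 → ℝ) (S s : ℕ) : Set 𝓧 :=
  {x | x ∈ alive κ l u s ∧ (s < S → κ s < width l u s x)}

/-- The truncated increment of the lower envelope. -/
noncomputable def increment (κ : ℕ → ℝ) (l u : ℕ → 𝓧 → ℝ) (s : ℕ) : 𝓧 → ℝ :=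
  (alive κ l u (s + 1)).indicator fun x => lowerEnvelope l (s + 1) x - lowerEnvelope l s x

/-- The width at the points where chaining is stopped at generation `s`. -/
noncomputable def excess (κ : ℕ → ℝ) (l u : ℕ → 𝓧 → ℝ) (S s : ℕ) : 𝓧 → ℝ :=
  (stopped κ l u S s).indicator (width l u s)

theorem lowerEnvelope_congr {l l' : ℕ → 𝓧 → ℝ} {s : ℕ} (h : ∀ k ≤ s, l k = l' k) :
    lowerEnvelope l s = lowerEnvelope l' s := by
  induction s with
  | zero => exact h 0 le_rfl
  | succ s ih => simp only [lowerEnvelope, ih fun k hk => h k (by omega), h (s + 1) le_rfl]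

theorem upperEnvelope_congr {u u' : ℕ → 𝓧 → ℝ} {s : ℕ} (h : ∀ k ≤ s, u k = u' k) :
    upperEnvelope u s = upperEnvelope u' s := by
  induction s with
  | zero => exact h 0 le_rfl
  | succ s ih => simp only [upperEnvelope, ih fun k hk => h k (by omega), h (s + 1) le_rfl]

section Congr

variable {κ : ℕ → ℝ} {l l' u u' : ℕ → 𝓧 → ℝ}

theorem width_congr {s : ℕ} (hl : ∀ k ≤ s, l k = l' k) (hu : ∀ k ≤ s, u k = u' k) :
    width l u s = width l' u' s := by
  ext x
  rw [width, width, lowerEnvelope_congr hl, upperEnvelope_congr hu]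

theorem alive_congr {s : ℕ} (hl : ∀ k < s, l k = l' k) (hu : ∀ k < s, u k = u' k) :
    alive κ l u s = alive κ l' u' s := by
  ext x
  refine forall₂_congr fun k hk => ?_
  rw [width_congr (fun j hj => hl j (by omega)) (fun j hj => hu j (by omega))]

theorem increment_congr {s : ℕ} (hl : ∀ k ≤ s + 1, l k = l' k) (hu : ∀ k ≤ s + 1, u k = u' k) :
    increment κ l u s = increment κ l' u' s := by
  rw [increment, increment, alive_congr (fun k hk => hl k hk.le) (fun k hk => hu k hk.le),
    lowerEnvelope_congr hl, lowerEnvelope_congr fun k hk => hl k (by omega)]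

theorem excess_congr {S s : ℕ} (hl : ∀ k ≤ s, l k = l' k) (hu : ∀ k ≤ s, u k = u' k) :
    excess κ l u S s = excess κ l' u' S s := by
  rw [excess, excess, stopped, stopped, width_congr hl hu,
    alive_congr (fun k hk => hl k hk.le) (fun k hk => hu k hk.le)]

end Congr

section Bounds

variable {κ : ℕ → ℝ} {l u : ℕ → 𝓧 → ℝ} {S s : ℕ}

theorem le_lowerEnvelope (l : ℕ → 𝓧 → ℝ) (s : ℕ) (x : 𝓧) : l s x ≤ lowerEnvelope l s x := by
  cases s with
  | zero => exact le_rfl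
  | succ s => exact le_max_right _ _

theorem upperEnvelope_le (u : ℕ → 𝓧 → ℝ) (s : ℕ) (x : 𝓧) : upperEnvelope u s x ≤ u s x := by
  cases s with
  | zero => exact le_rfl
  | succ s => exact min_le_right _ _

theorem width_le (l u : ℕ → 𝓧 → ℝ) (s : ℕ) (x : 𝓧) : width l u s x ≤ u s x - l s x :=
  sub_le_sub (upperEnvelope_le u s x) (le_lowerEnvelope l s x)

theorem width_succ_le (l u : ℕ → 𝓧 → ℝ) (s : ℕ) (x : 𝓧) : width l u (s + 1) x ≤ width l u s x :=
  sub_le_sub (min_le_left _ _) (le_max_left _ _)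

theorem lowerEnvelope_le {g : 𝓧 → ℝ} (h : ∀ k ≤ s, l k ≤ g) (x : 𝓧) :
    lowerEnvelope l s x ≤ g x := by
  induction s with
  | zero => exact h 0 le_rfl x
  | succ s ih => exact max_le (ih fun k hk => h k (by omega)) (h (s + 1) le_rfl x)

theorem le_upperEnvelope {g : 𝓧 → ℝ} (h : ∀ k ≤ s, g ≤ u k) (x : 𝓧) :
    g x ≤ upperEnvelope u s x := by
  induction s with
  | zero => exact h 0 le_rfl x
  | succ s ih => exact le_min (ih fun k hk => h k (by omega)) (h (s + 1) le_rfl x)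

theorem alive_succ_subset : alive κ l u (s + 1) ⊆ alive κ l u s :=
  fun _ hx k hk => hx k (by omega)

theorem mem_alive_succ {x : 𝓧} :
    x ∈ alive κ l u (s + 1) ↔ x ∈ alive κ l u s ∧ width l u s x ≤ κ s := by
  refine ⟨fun h => ⟨alive_succ_subset h, h s (by omega)⟩, fun h k hk => ?_⟩
  rcases Nat.lt_succ_iff_lt_or_eq.1 hk with h' | rfl
  · exact h.1 k h'
  · exact h.2

/-- One step of the chaining decomposition. -/
theorem indicator_alive_eq (g : 𝓧 → ℝ) (hs : s < S) :
    (alive κ l u s).indicator (fun x => g x - lowerEnvelope l s x)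
      = (stopped κ l u S s).indicator (fun x => g x - lowerEnvelope l s x)
        + (increment κ l u s
          + (alive κ l u (s + 1)).indicator (fun x => g x - lowerEnvelope l (s + 1) x)) := by
  classical
  ext x
  simp only [Pi.add_apply, increment, Set.indicator_apply, stopped, mem_alive_succ,
    Set.mem_ofPred_eq]
  -- A point alive at `s` either stops there or survives to `s + 1`; in the second case `g - Λ_s`
  -- splits through `Λ_{s+1}`.
  by_cases h1 : x ∈ alive κ l u s <;> by_cases h2 : width l u s x ≤ κ s <;>
    simp [h1, h2, hs, not_lt.2, lt_of_not_ge]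

end Bounds

section Measurability

variable [MeasurableSpace 𝓧] {κ : ℕ → ℝ} {l u : ℕ → 𝓧 → ℝ}

theorem measurable_lowerEnvelope (hl : ∀ k, Measurable (l k)) (s : ℕ) :
    Measurable (lowerEnvelope l s) := by
  induction s with
  | zero => exact hl 0
  | succ s ih => exact ih.max (hl _)

theorem measurable_upperEnvelope (hu : ∀ k, Measurable (u k)) (s : ℕ) :
    Measurable (upperEnvelope u s) := by
  induction s with
  | zero => exact hu 0
  | succ s ih => exact ih.min (hu _)

theorem measurable_width (hl : ∀ k, Measurable (l k)) (hu : ∀ k, Measurable (u k)) (s : ℕ) :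
    Measurable (width l u s) :=
  (measurable_upperEnvelope hu s).sub (measurable_lowerEnvelope hl s)

theorem measurableSet_alive (hl : ∀ k, Measurable (l k)) (hu : ∀ k, Measurable (u k)) (s : ℕ) :
    MeasurableSet (alive κ l u s) := by
  induction s with
  | zero => simp [alive]
  | succ s ih =>
    have : alive κ l u (s + 1) = alive κ l u s ∩ {x | width l u s x ≤ κ s} := by
      ext x
      exact mem_alive_succ
    rw [this]
    exact ih.inter (measurableSet_le (measurable_width hl hu s) measurable_const)

theorem measurableSet_stopped (hl : ∀ k, Measurable (l k)) (hu : ∀ k, Measurable (u k))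
    (S s : ℕ) : MeasurableSet (stopped κ l u S s) := by
  have h2 : MeasurableSet {x | s < S → κ s < width l u s x} := by
    by_cases h : s < S
    · have e : {x | s < S → κ s < width l u s x} = {x | κ s < width l u s x} := by simp [h]
      rw [e]
      exact measurableSet_lt measurable_const (measurable_width hl hu s)
    · rw [Set.eq_univ_of_forall (s := {x | s < S → κ s < width l u s x}) fun x h' => absurd h' h]
      exact MeasurableSet.univ
  exact (measurableSet_alive hl hu s).inter h2

theorem measurable_increment (hl : ∀ k, Measurable (l k)) (hu : ∀ k, Measurable (u k)) (s : ℕ) :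
    Measurable (increment κ l u s) :=
  ((measurable_lowerEnvelope hl (s + 1)).sub (measurable_lowerEnvelope hl s)).indicator
    (measurableSet_alive hl hu (s + 1))

theorem measurable_excess (hl : ∀ k, Measurable (l k)) (hu : ∀ k, Measurable (u k)) (S s : ℕ) :
    Measurable (excess κ l u S s) :=
  (measurable_width hl hu s).indicator (measurableSet_stopped hl hu S s)

end Measurability

end Envelopes

/-! ### The chaining bound along one branch -/

section Chaining

variable {Ω 𝓧 : Type*} [MeasurableSpace Ω] [MeasurableSpace 𝓧] {n : ℕ}

/-- A function `g` caught in brackets `[l_k, u_k]` with `‖u_k - l_k‖ ≤ 2^{-k}` for `k ≤ S`. -/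
structure IsBracketed (μ : Measure Ω) (X : Fin n → Ω → 𝓧) (S : ℕ) (g : 𝓧 → ℝ)
    (l u : ℕ → 𝓧 → ℝ) : Prop where
  measurable_g : Measurable g
  measurable_l : ∀ k, Measurable (l k)
  measurable_u : ∀ k, Measurable (u k)
  le_g : ∀ k ≤ S, l k ≤ g
  g_le : ∀ k ≤ S, g ≤ u k
  absMoment_le : ∀ k ≤ S, absMoment μ X 2 (u k - l k) ≤ ENNReal.ofReal ((2⁻¹ ^ k) ^ 2)
  absMoment_ne_top : absMoment μ X 2 g ≠ ⊤

variable {μ : Measure Ω} {X : Fin n → Ω → 𝓧} {S s : ℕ} {g : 𝓧 → ℝ} {κ : ℕ → ℝ}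
  {l u : ℕ → 𝓧 → ℝ}

namespace IsBracketed

section Pointwise

variable (h : IsBracketed μ X S g l u)

include h

theorem lowerEnvelope_le (hs : s ≤ S) (x : 𝓧) : lowerEnvelope l s x ≤ g x :=
  _root_.lowerEnvelope_le (fun k hk => h.le_g k (hk.trans hs)) x

theorem sub_lowerEnvelope_le (hs : s ≤ S) (x : 𝓧) : g x - lowerEnvelope l s x ≤ width l u s x :=
  sub_le_sub_right (le_upperEnvelope (fun k hk => h.g_le k (hk.trans hs)) x) _

theorem width_nonneg (hs : s ≤ S) (x : 𝓧) : 0 ≤ width l u s x :=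
  (sub_nonneg.2 (h.lowerEnvelope_le hs x)).trans (h.sub_lowerEnvelope_le hs x)

theorem absMoment_width_le (hs : s ≤ S) :
    absMoment μ X 2 (width l u s) ≤ ENNReal.ofReal ((2⁻¹ ^ s) ^ 2) := by
  refine (absMoment_mono 2 fun x => ?_).trans (h.absMoment_le s hs)
  rw [abs_of_nonneg (h.width_nonneg hs x)]
  exact (width_le l u s x).trans (le_abs_self _)

theorem abs_increment_le (hs : s < S) (x : 𝓧) : |increment κ l u s x| ≤ |width l u s x| := by
  rw [abs_of_nonneg (h.width_nonneg hs.le x)]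
  by_cases hx : x ∈ alive κ l u (s + 1)
  · rw [increment, Set.indicator_of_mem hx,
      abs_of_nonneg (sub_nonneg.2 (show lowerEnvelope l s x ≤ lowerEnvelope l (s + 1) x from
        le_max_left _ _))]
    exact (sub_le_sub_right (h.lowerEnvelope_le hs x) _).trans (h.sub_lowerEnvelope_le hs.le x)
  · rw [increment, Set.indicator_of_notMem hx, abs_zero]
    exact h.width_nonneg hs.le x

theorem abs_increment_le_level (hκ : ∀ k, 0 < κ k) (hs : s < S) (x : 𝓧) :
    |increment κ l u s x| ≤ κ s := by
  by_cases hx : x ∈ alive κ l u (s + 1)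
  · refine (h.abs_increment_le hs x).trans ?_
    rw [abs_of_nonneg (h.width_nonneg hs.le x)]
    exact (mem_alive_succ.1 hx).2
  · rw [increment, Set.indicator_of_notMem hx, abs_zero]
    exact (hκ s).le

theorem excess_nonneg (hs : s ≤ S) (x : 𝓧) : 0 ≤ excess κ l u S s x :=
  Set.indicator_nonneg (fun x _ => h.width_nonneg hs x) x

theorem excess_le_width (hs : s ≤ S) (x : 𝓧) : excess κ l u S s x ≤ width l u s x :=
  Set.indicator_le_self' (fun x _ => h.width_nonneg hs x) x

theorem abs_excess_le (hs : s ≤ S) (x : 𝓧) : |excess κ l u S s x| ≤ |width l u s x| :=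
  abs_le_abs_of_nonneg (h.excess_nonneg hs x) (h.excess_le_width hs x)

/-- Reaching generation `s + 1` means `w_s ≤ κ_s`, and widths decrease. The excess therefore
inherits the level of the previous generation, the same level as the increment it is paired with. -/
theorem abs_excess_succ_le_level (hκ : ∀ k, 0 < κ k) (hs : s < S) (x : 𝓧) :
    |excess κ l u S (s + 1) x| ≤ κ s := by
  by_cases hx : x ∈ stopped κ l u S (s + 1)
  · refine (h.abs_excess_le hs x).trans ?_
    rw [abs_of_nonneg (h.width_nonneg hs x)]
    exact (width_succ_le l u s x).trans (mem_alive_succ.1 hx.1).2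
  · rw [excess, Set.indicator_of_notMem hx, abs_zero]
    exact (hκ s).le

/-- On the stopped set `κ_s < w_s`, so `w_s ≤ w_s² / κ_s`, a Markov-type bound. -/
theorem excess_le_sq_div (hκ : ∀ k, 0 < κ k) (hs : s < S) (x : 𝓧) :
    excess κ l u S s x ≤ (κ s)⁻¹ * width l u s x ^ 2 := by
  have hk := hκ s
  by_cases hx : x ∈ stopped κ l u S s
  · rw [excess, Set.indicator_of_mem hx, inv_mul_eq_div, le_div_iff₀ hk, sq]
    exact mul_le_mul_of_nonneg_left (hx.2 hs).le (h.width_nonneg hs.le x)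
  · rw [excess, Set.indicator_of_notMem hx]
    positivity

end Pointwise

variable [IsProbabilityMeasure μ]

section Integrable

variable (h : IsBracketed μ X S g l u) (hX : ∀ i, Measurable (X i)) (hn : 1 ≤ n)

include h hX hn

theorem integrable_of_abs_le_width (hs : s ≤ S) {f : 𝓧 → ℝ} (hf : Measurable f)
    (hfw : ∀ x, |f x| ≤ |width l u s x|) (i : Fin n) : Integrable (fun ω => f (X i ω)) μ :=
  integrable_comp hX hf (((absMoment_mono 2 hfw).trans (h.absMoment_width_le hs)).trans_lt
    ENNReal.ofReal_lt_top).ne hn i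

theorem integrable_excess (hs : s ≤ S) (i : Fin n) :
    Integrable (fun ω => excess κ l u S s (X i ω)) μ :=
  h.integrable_of_abs_le_width hX hn hs (measurable_excess h.measurable_l h.measurable_u S s)
    (h.abs_excess_le hs) i

theorem avgMean_excess_le (hκ : ∀ k, 0 < κ k) (hs : s < S) :
    avgMean μ X (excess κ l u S s) ≤ 2⁻¹ ^ (2 * s) / κ s := by
  have hk := hκ s
  refine (avgMean_le_of_le_sq hX hn (h.integrable_excess hX hn hs.le)
    (measurable_width h.measurable_l h.measurable_u s) (sq_nonneg _) (inv_pos.2 hk).le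
    (h.absMoment_width_le hs.le) (c := 0) fun x => ?_).trans (le_of_eq ?_)
  · rw [add_zero]
    exact h.excess_le_sq_div hκ hs x
  · rw [add_zero, inv_mul_eq_div, ← pow_mul, mul_comm s 2]

theorem avgMean_excess_last_le : avgMean μ X (excess κ l u S S) ≤ 2⁻¹ ^ S := by
  set ε : ℝ := 2⁻¹ ^ S with hε
  have hε0 : 0 < ε := by positivity
  refine (avgMean_le_of_le_sq hX hn (h.integrable_excess hX hn le_rfl)
    (measurable_width h.measurable_l h.measurable_u S) (sq_nonneg _)
    (show 0 ≤ (2 * ε)⁻¹ by positivity) (h.absMoment_width_le le_rfl) (c := ε / 2)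
    fun x => ?_).trans (le_of_eq ?_)
  · refine (h.excess_le_width le_rfl x).trans ?_
    set w := width l u S x
    have e : (2 * ε)⁻¹ * w ^ 2 + ε / 2 - w = (2 * ε)⁻¹ * (w - ε) ^ 2 := by
      field_simp
      ring
    have : 0 ≤ (2 * ε)⁻¹ * (w - ε) ^ 2 := by positivity
    linarith
  · field_simp
    ring

theorem integrable_indicator_sub (hs : s ≤ S) {A : Set 𝓧} (hA : MeasurableSet A) (i : Fin n) :
    Integrable (fun ω => A.indicator (fun x => g x - lowerEnvelope l s x) (X i ω)) μ := by
  refine h.integrable_of_abs_le_width hX hn hs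
    ((h.measurable_g.sub (measurable_lowerEnvelope h.measurable_l s)).indicator hA)
    (fun x => ?_) i
  refine abs_le_abs_of_nonneg
    (Set.indicator_nonneg (fun x _ => sub_nonneg.2 (h.lowerEnvelope_le hs x)) x) ?_
  exact (Set.indicator_le_self' (fun x _ => sub_nonneg.2 (h.lowerEnvelope_le hs x)) x).trans
    (h.sub_lowerEnvelope_le hs x)

theorem abs_stopped_le (hs : s ≤ S) (ω : Ω) :
    |(empiricalProcess μ X
        ((stopped κ l u S s).indicator fun x => g x - lowerEnvelope l s x) ω)|
      ≤ |(empiricalProcess μ X (excess κ l u S s) ω)|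
        + Real.sqrt n * avgMean μ X (excess κ l u S s) :=
  abs_empiricalProcess_le_of_le
    (h.integrable_indicator_sub hX hn hs (measurableSet_stopped h.measurable_l h.measurable_u S s))
    (h.integrable_excess hX hn hs)
    (Set.indicator_nonneg fun x _ => sub_nonneg.2 (h.lowerEnvelope_le hs x))
    (fun x => Set.indicator_le_indicator (h.sub_lowerEnvelope_le hs x)) ω

/-- Induction on the depth reached, keeping the part of `g - Λ_m` still alive as remainder, so that
each step uses one splitting and one bias estimate. -/
theorem abs_empiricalProcess_le_partial (m : ℕ) (hm : m ≤ S) (ω : Ω) :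
    |(empiricalProcess μ X g ω)| ≤ |(empiricalProcess μ X (lowerEnvelope l 0) ω)|
      + ∑ s ∈ Finset.range m, (|(empiricalProcess μ X (increment κ l u s) ω)|
        + |(empiricalProcess μ X (excess κ l u S s) ω)|
        + Real.sqrt n * avgMean μ X (excess κ l u S s))
      + |(empiricalProcess μ X
          ((alive κ l u m).indicator fun x => g x - lowerEnvelope l m x) ω)| := by
  have hA : ∀ s, MeasurableSet (alive κ l u s) := measurableSet_alive h.measurable_l h.measurable_u
  induction m with
  | zero =>
    have h1 := h.integrable_indicator_sub hX hn (Nat.zero_le S) (hA 0)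
    have hg := integrable_comp hX h.measurable_g h.absMoment_ne_top hn
    have e0 : (alive κ l u 0).indicator (fun x => g x - lowerEnvelope l 0 x)
        = g - lowerEnvelope l 0 := by
      have : alive κ l u 0 = Set.univ := by simp [alive]
      rw [this, Set.indicator_univ]
      rfl
    rw [e0] at h1 ⊢
    -- Integrability of the lower bracket is recovered from that of `g` and of `g - l_0`.
    have h2 : ∀ i, Integrable (fun ω => lowerEnvelope l 0 (X i ω)) μ := fun i => by
      have := (hg i).sub (h1 i)
      refine this.congr (Filter.Eventually.of_forall fun ω => ?_)
      simp
    have e : g = lowerEnvelope l 0 + (g - lowerEnvelope l 0) := by simp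
    rw [Finset.sum_range_zero, add_zero]
    conv_lhs => rw [e, empiricalProcess_add h2 h1]
    exact abs_add_le _ _
  | succ m ih =>
    have hm' : m < S := hm
    have h1 := h.integrable_indicator_sub hX hn hm'.le
      (measurableSet_stopped (κ := κ) h.measurable_l h.measurable_u S m)
    have h2 := h.integrable_of_abs_le_width hX hn hm'.le
      (measurable_increment (κ := κ) h.measurable_l h.measurable_u m) (h.abs_increment_le hm')
    have h3 := h.integrable_indicator_sub hX hn hm (hA (m + 1))
    refine (ih hm'.le).trans ?_
    rw [indicator_alive_eq g hm', empiricalProcess_add h1 fun i => (h2 i).add (h3 i),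
      empiricalProcess_add h2 h3, Finset.sum_range_succ]
    have a1 := abs_add_le (empiricalProcess μ X
        ((stopped κ l u S m).indicator fun x => g x - lowerEnvelope l m x) ω)
      (empiricalProcess μ X (increment κ l u m) ω + empiricalProcess μ X
        ((alive κ l u (m + 1)).indicator fun x => g x - lowerEnvelope l (m + 1) x) ω)
    have a2 := abs_add_le (empiricalProcess μ X (increment κ l u m) ω) (empiricalProcess μ X
        ((alive κ l u (m + 1)).indicator fun x => g x - lowerEnvelope l (m + 1) x) ω)
    have a3 := h.abs_stopped_le hX hn hm'.le (κ := κ) ω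
    linarith

end Integrable

end IsBracketed

/-- The labels of the tree chain along the branch of `g`. -/
noncomputable def chainLabel (μ : Measure Ω) (X : Fin n → Ω → 𝓧) (κ : ℕ → ℝ) (S : ℕ)
    (l u : ℕ → 𝓧 → ℝ) : ℕ → Ω → ℝ
  | 0 => fun ω => |(empiricalProcess μ X (lowerEnvelope l 0) ω)|
      + |(empiricalProcess μ X (excess κ l u S 0) ω)|
  | s + 1 => fun ω => |(empiricalProcess μ X (increment κ l u s) ω)|
      + |(empiricalProcess μ X (excess κ l u S (s + 1)) ω)|

omit [MeasurableSpace 𝓧] in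
theorem chainLabel_nonneg (s : ℕ) (ω : Ω) : 0 ≤ chainLabel μ X κ S l u s ω := by
  cases s <;> simp only [chainLabel] <;> positivity

omit [MeasurableSpace 𝓧] in
theorem chainLabel_congr {l' u' : ℕ → 𝓧 → ℝ} (hl : ∀ k ≤ s, l k = l' k)
    (hu : ∀ k ≤ s, u k = u' k) : chainLabel μ X κ S l u s = chainLabel μ X κ S l' u' s := by
  cases s with
  | zero => simp only [chainLabel, lowerEnvelope_congr hl, excess_congr hl hu]
  | succ s => simp only [chainLabel, increment_congr hl hu, excess_congr hl hu]

namespace IsBracketed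

variable (h : IsBracketed μ X S g l u)

include h

theorem measurable_chainLabel (hX : ∀ i, Measurable (X i)) (s : ℕ) :
    Measurable (chainLabel μ X κ S l u s) := by
  have h1 := fun s => measurable_empiricalProcess (μ := μ) hX
    (measurable_excess (κ := κ) h.measurable_l h.measurable_u S s)
  have h2 := fun s => measurable_empiricalProcess (μ := μ) hX
    (measurable_increment (κ := κ) h.measurable_l h.measurable_u s)
  have h3 := measurable_empiricalProcess (μ := μ) hX (measurable_lowerEnvelope h.measurable_l 0)
  cases s with
  | zero => exact h3.abs.add (h1 0).abs
  | succ s => exact (h2 s).abs.add (h1 (s + 1)).abs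

variable [IsProbabilityMeasure μ] (hX : ∀ i, Measurable (X i)) (hn : 1 ≤ n)

include hX hn

/-- The pathwise chaining bound. -/
theorem abs_empiricalProcess_le (hκ : ∀ k, 0 < κ k) (ω : Ω) :
    |(empiricalProcess μ X g ω)| ≤ ∑ s ∈ Finset.range (S + 1), chainLabel μ X κ S l u s ω
      + (4 * Real.sqrt n * ∑ s ∈ Finset.range S, 2⁻¹ ^ (2 * (s + 1)) / κ s
        + Real.sqrt n * 2⁻¹ ^ S) := by
  have h1 := h.abs_empiricalProcess_le_partial hX hn S le_rfl (κ := κ) ω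
  have h2 := h.abs_stopped_le hX hn le_rfl (κ := κ) ω
  -- No threshold applies at depth `S`, so the surviving remainder is itself a stopped term.
  have e : stopped κ l u S S = alive κ l u S := by
    ext x
    simp [stopped]
  rw [e] at h2
  have hq := Real.sqrt_nonneg (n : ℝ)
  have h3 := mul_le_mul_of_nonneg_left (h.avgMean_excess_last_le hX hn (κ := κ)) hq
  have h4 : ∑ s ∈ Finset.range S, Real.sqrt n * avgMean μ X (excess κ l u S s)
      ≤ 4 * Real.sqrt n * ∑ s ∈ Finset.range S, 2⁻¹ ^ (2 * (s + 1)) / κ s := by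
    rw [Finset.mul_sum]
    refine Finset.sum_le_sum fun s hs => ?_
    refine (mul_le_mul_of_nonneg_left
      (h.avgMean_excess_le hX hn hκ (Finset.mem_range.1 hs)) hq).trans (le_of_eq ?_)
    -- The factor 4 in `δ` comes from `2^{-2s} = 4 · 2^{-2(s+1)}`.
    rw [mul_add, pow_add]
    ring
  have h5 : ∑ s ∈ Finset.range (S + 1), chainLabel μ X κ S l u s ω
      = |(empiricalProcess μ X (lowerEnvelope l 0) ω)|
        + ∑ s ∈ Finset.range S, (|(empiricalProcess μ X (increment κ l u s) ω)|
          + |(empiricalProcess μ X (excess κ l u S s) ω)|)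
        + |(empiricalProcess μ X (excess κ l u S S) ω)| := by
    rw [Finset.sum_range_succ']
    simp only [chainLabel]
    rw [Finset.sum_add_distrib, Finset.sum_add_distrib]
    -- Label `s + 1` pairs increment `s` with excess `s + 1`, so the sum of the excesses has to be
    -- shifted by one.
    have := Finset.sum_range_succ' (fun s => |(empiricalProcess μ X (excess κ l u S s) ω)|) S
    rw [Finset.sum_range_succ] at this
    linarith
  rw [Finset.sum_add_distrib] at h1
  linarith

/-- The two terms have parameters `(σ, b) = (2, 8K)` and `(1, 4K)`. The common ratio `b/σ = 4K`
gives one `L_0`, and the norms add to `√6 (2 + 1)`. -/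
theorem bernsteinOrliczNorm_chainLabel_zero_le (hind : iIndepFun X μ) {K : ℝ} (hK : 0 < K)
    (hg : BernsteinCondition μ X g 1 K) (hw : BernsteinCondition μ X (u 0 - l 0) 1 (2 * K)) :
    bernsteinOrliczNorm (4 * Real.sqrt 6 * K / Real.sqrt n) (chainLabel μ X κ S l u 0) μ
      ≤ ENNReal.ofReal (3 * Real.sqrt 6) := by
  have hn' : (0 : ℝ) < n := by exact_mod_cast hn
  have hsn := Real.sqrt_pos.2 hn'
  have m1 := measurable_lowerEnvelope h.measurable_l 0
  have m2 := measurable_excess (κ := κ) h.measurable_l h.measurable_u S 0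
  have B1 : BernsteinCondition μ X (lowerEnvelope l 0) 2 (8 * K) := by
    have hd : BernsteinCondition μ X (g - l 0) 1 (2 * K) :=
      hw.mono (by positivity) le_rfl fun x => abs_le_abs_of_nonneg
        (sub_nonneg.2 (h.le_g 0 (Nat.zero_le S) x))
        (sub_le_sub_right (h.g_le 0 (Nat.zero_le S) x) _)
    have := BernsteinCondition.sub hX h.measurable_g hK.le hg hd
    rwa [sub_sub_cancel] at this
  have B2 : BernsteinCondition μ X (excess κ l u S 0) 1 (4 * K) :=
    hw.mono (by positivity) (by linarith) (h.abs_excess_le (Nat.zero_le S))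
  have h1 := lintegral_Psi_empiricalProcess_le_one hX hind m1 hn two_pos (by positivity) B1
    (L := 4 * Real.sqrt 6 * K / Real.sqrt n) (by field_simp; ring)
  have h2 := lintegral_Psi_empiricalProcess_le_one hX hind m2 hn one_pos (by positivity) B2
    (L := 4 * Real.sqrt 6 * K / Real.sqrt n) (by field_simp)
  refine (bernsteinOrliczNorm_add_le (measurable_empiricalProcess hX m1)
    (measurable_empiricalProcess hX m2) (by positivity) (by positivity) (by positivity) h1
    h2).trans (le_of_eq ?_)
  congr 1
  ring

/-- Both functions are bounded by `κ_s`, so any scale from `κ_s/3` on is allowed. The choices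
`4κ_s/3` and `2κ_s/3` equalize `b/σ` for `σ = 2^{-s}` and `2^{-(s+1)}`, and `2^{-s} + 2^{-(s+1)} = 3
· 2^{-(s+1)}`. -/
theorem bernsteinOrliczNorm_chainLabel_succ_le (hind : iIndepFun X μ) (hκ : ∀ k, 0 < κ k)
    (hs : s < S) :
    bernsteinOrliczNorm (2 * Real.sqrt 6 * 2 ^ (s + 1) * κ s / (3 * Real.sqrt n))
      (chainLabel μ X κ S l u (s + 1)) μ ≤ ENNReal.ofReal (3 * Real.sqrt 6 * 2⁻¹ ^ (s + 1)) := by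
  have hn' : (0 : ℝ) < n := by exact_mod_cast hn
  have hsn := Real.sqrt_pos.2 hn'
  have hk := hκ s
  have m1 := measurable_increment (κ := κ) h.measurable_l h.measurable_u s
  have m2 := measurable_excess (κ := κ) h.measurable_l h.measurable_u S (s + 1)
  have B1 : BernsteinCondition μ X (increment κ l u s) (2⁻¹ ^ s) (4 / 3 * κ s) :=
    BernsteinCondition.of_bounded hk.le (by linarith) (h.abs_increment_le_level hκ hs)
      ((absMoment_mono 2 (h.abs_increment_le hs)).trans (h.absMoment_width_le hs.le))
  have B2 : BernsteinCondition μ X (excess κ l u S (s + 1)) (2⁻¹ ^ (s + 1)) (2 / 3 * κ s) :=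
    BernsteinCondition.of_bounded hk.le (by linarith) (h.abs_excess_succ_le_level hκ hs)
      ((absMoment_mono 2 (h.abs_excess_le hs)).trans (h.absMoment_width_le hs))
  have h1 := lintegral_Psi_empiricalProcess_le_one hX hind m1 hn (by positivity) (by positivity) B1
    (L := 2 * Real.sqrt 6 * 2 ^ (s + 1) * κ s / (3 * Real.sqrt n))
    (by rw [inv_pow]; field_simp; ring)
  have h2 := lintegral_Psi_empiricalProcess_le_one hX hind m2 hn (by positivity) (by positivity) B2
    (L := 2 * Real.sqrt 6 * 2 ^ (s + 1) * κ s / (3 * Real.sqrt n))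
    (by rw [inv_pow]; field_simp)
  refine (bernsteinOrliczNorm_add_le (measurable_empiricalProcess hX m1)
    (measurable_empiricalProcess hX m2) (by positivity) (by positivity) (by positivity) h1
    h2).trans (le_of_eq ?_)
  congr 1
  rw [pow_succ]
  ring

end IsBracketed

end Chaining

/-! ### Minimal bracketing sets and assembly of the tree chain -/

theorem exists_eq_iInf_natCast {p : ℕ → Prop} (h : (⨅ (N : ℕ) (_ : p N), (N : ℕ∞)) ≠ ⊤) :
    ∃ N, p N ∧ (N : ℕ∞) = ⨅ (N : ℕ) (_ : p N), (N : ℕ∞) := by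
  classical
  have hp : ∃ N, p N := by
    by_contra! hp
    exact h (by simp [hp])
  refine ⟨Nat.find hp, Nat.find_spec hp, le_antisymm ?_ (iInf₂_le _ (Nat.find_spec hp))⟩
  exact le_iInf₂ fun N hN => Nat.cast_le.2 (Nat.find_min' hp hN)

theorem bernsteinOrliczNorm_zero_le {Ω : Type*} [MeasurableSpace Ω] (μ : Measure Ω) (L : ℝ)
    {c : ℝ} (hc : 0 < c) : bernsteinOrliczNorm L (0 : Ω → ℝ) μ ≤ ENNReal.ofReal c :=
  orliczNorm_le hc (by simp [Psi_zero])

section Brackets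

variable {Ω 𝓧 : Type*} [MeasurableSpace Ω] [MeasurableSpace 𝓧] {n : ℕ} {μ : Measure Ω}
  {X : Fin n → Ω → 𝓧} {𝓖 : Set (𝓧 → ℝ)} {K : ℝ}

omit [MeasurableSpace 𝓧] in
theorem bernsteinCondition_one_of_moment_le {h : 𝓧 → ℝ} {b : ℝ}
    (hh : ∀ m : ℕ, 2 ≤ m → absMoment μ X m h ≤ ENNReal.ofReal ((m ! : ℝ) / 2 * b ^ (m - 2))) :
    BernsteinCondition μ X h 1 b := fun m => by
  simpa using hh (m + 2) (by omega)

/-- A finite bracketing number is attained by brackets of the corresponding generation. -/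
theorem exists_brackets (k : ℕ) (hfin : bracketingNumber μ X 𝓖 K k ≠ ⊤) :
    ∃ (N : ℕ) (lo up : Fin N → 𝓧 → ℝ) (c : 𝓖 → Fin N),
      (∀ j, Measurable (lo j)) ∧ (∀ j, Measurable (up j)) ∧
      (N : ℕ∞) = bracketingNumber μ X 𝓖 K k ∧
      (k = 0 → ∀ j, BernsteinCondition μ X (up j - lo j) 1 (2 * K)) ∧
      (∀ j, absMoment μ X 2 (up j - lo j) ≤ ENNReal.ofReal ((2⁻¹ ^ k) ^ 2)) ∧
      ∀ g : 𝓖, lo (c g) ≤ g ∧ (g : 𝓧 → ℝ) ≤ up (c g) := by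
  rcases Nat.eq_zero_or_pos k with rfl | hk
  · simp only [bracketingNumber, if_true] at hfin ⊢
    obtain ⟨N, ⟨lo, up, hB⟩, hN⟩ := exists_eq_iInf_natCast hfin
    choose c hc using fun g : 𝓖 => hB.exists_bracket g g.2
    refine ⟨N, lo, up, c, hB.measurable_lo, hB.measurable_up, hN,
      fun _ j => bernsteinCondition_one_of_moment_le (hB.moment_le j), fun j => ?_, hc⟩
    -- The case `m = 2` says that the bracket has norm at most `1 = 2^{-0}`.
    simpa using hB.moment_le j 2 le_rfl
  · simp only [bracketingNumber, if_neg hk.ne'] at hfin ⊢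
    obtain ⟨N, ⟨lo, up, hB⟩, hN⟩ := exists_eq_iInf_natCast hfin
    choose c hc using fun g : 𝓖 => hB.exists_bracket g g.2
    exact ⟨N, lo, up, c, hB.measurable_lo, hB.measurable_up, hN, fun h => absurd h hk.ne',
      fun j => absMoment_two_le_of_avgNorm_le (by positivity) (hB.size_le j), hc⟩

end Brackets


theorem mainTheorem3 {Ω 𝓧 : Type*} [MeasurableSpace Ω] [MeasurableSpace 𝓧]
    (μ : Measure Ω) [IsProbabilityMeasure μ]
    (n : ℕ) (hn : 1 ≤ n) (X : Fin n → Ω → 𝓧) (hX : ∀ i, Measurable (X i)) (hind : iIndepFun X μ)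
    (𝓖 : Set (𝓧 → ℝ)) (h𝓖 : ∀ g ∈ 𝓖, Measurable g)
    (K : ℝ) (hK : 1 ≤ K)
    (hBernstein : ∀ g ∈ 𝓖, ∀ m : ℕ, 2 ≤ m →
      absMoment μ X m g ≤ ENNReal.ofReal ((m ! : ℝ) / 2 * K ^ (m - 2)))
    (S : ℕ) (κ : Fin S → ℝ) (hκ_pos : ∀ s, 0 < κ s) (hκ_anti : Antitone κ)
    (hfin : ∀ s ≤ S, bracketingNumber μ X 𝓖 K s ≠ ⊤) :
    ∃ (T : FiniteTree S) (W : Fin T.N → Ω → ℝ),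
      IsFiniteTreeChain μ
        (4 * Real.sqrt n * ∑ s : Fin S, 2⁻¹ ^ (2 * ((s : ℕ) + 1)) / κ s + Real.sqrt n * 2⁻¹ ^ S)
        (3 * Real.sqrt 6)
        (Fin.cons (4 * Real.sqrt 6 * K / Real.sqrt n)
          (fun s : Fin S =>
            2 * Real.sqrt 6 * 2 ^ ((s : ℕ) + 1) * κ s / (3 * Real.sqrt n)))
        (fun g : 𝓖 => empiricalProcess μ X (g : 𝓧 → ℝ)) T W ∧
      ∀ s : Fin (S + 1),
        ((T.gen s).card : ℕ∞) ≤
          ∏ k ∈ Finset.range ((s : ℕ) + 1), bracketingNumber μ X 𝓖 K k := by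
  have hn' : (0 : ℝ) < n := by exact_mod_cast hn
  have hsn := Real.sqrt_pos.2 hn'
  -- The value 1 beyond `S` only keeps the levels positive.
  let κ' : ℕ → ℝ := fun k => if h : k < S then κ ⟨k, h⟩ else 1
  have hκ' : ∀ k, 0 < κ' k := fun k => by
    simp only [κ']
    split_ifs with h
    · exact hκ_pos _
    · exact one_pos
  have hκκ' : ∀ s : Fin S, κ s = κ' s := fun s => by simp [κ']
  have hex : ∀ k, ∃ (N : ℕ) (lo up : Fin N → 𝓧 → ℝ) (c : 𝓖 → Fin N),
      (∀ j, Measurable (lo j)) ∧ (∀ j, Measurable (up j)) ∧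
      (k ≤ S → (N : ℕ∞) = bracketingNumber μ X 𝓖 K k ∧
        (k = 0 → ∀ j, BernsteinCondition μ X (up j - lo j) 1 (2 * K)) ∧
        (∀ j, absMoment μ X 2 (up j - lo j) ≤ ENNReal.ofReal ((2⁻¹ ^ k) ^ 2)) ∧
        ∀ g : 𝓖, lo (c g) ≤ g ∧ (g : 𝓧 → ℝ) ≤ up (c g)) := by
    intro k
    by_cases hk : k ≤ S
    · obtain ⟨N, lo, up, c, h1, h2, h3⟩ := exists_brackets k (hfin k hk)
      exact ⟨N, lo, up, c, h1, h2, fun _ => h3⟩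
    -- Beyond depth `S` a single dummy bracket makes the families total; nothing is claimed of it.
    · exact ⟨1, fun _ => 0, fun _ => 0, fun _ => 0, fun _ => measurable_zero,
        fun _ => measurable_zero, fun h => absurd h hk⟩
  choose N lo up c hlo hup hbr using hex
  let l : 𝓖 → ℕ → 𝓧 → ℝ := fun g k => lo k (c k g)
  let u : 𝓖 → ℕ → 𝓧 → ℝ := fun g k => up k (c k g)
  have hB : ∀ g : 𝓖, BernsteinCondition μ X g 1 K := fun g =>
    bernsteinCondition_one_of_moment_le (hBernstein g g.2)
  have hbk : ∀ g : 𝓖, IsBracketed μ X S g (l g) (u g) := fun g =>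
    { measurable_g := h𝓖 g g.2
      measurable_l := fun k => hlo k _
      measurable_u := fun k => hup k _
      le_g := fun k hk => ((hbr k hk).2.2.2 g).1
      g_le := fun k hk => ((hbr k hk).2.2.2 g).2
      absMoment_le := fun k hk => (hbr k hk).2.2.1 _
      absMoment_ne_top := (hB g).absMoment_two_ne_top }
  obtain ⟨T, W, hcard, hW, hbranch⟩ := exists_finiteTree_of_choice S N (fun g k => c k g)
    (fun s g => chainLabel μ X κ' S (l g) (u g) s) (fun s g g' hc =>
      chainLabel_congr (fun k hk => congrArg (lo k) (hc k hk))
        (fun k hk => congrArg (up k) (hc k hk)))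
  have hLpos : ∀ s, 0 < (Fin.cons (4 * Real.sqrt 6 * K / Real.sqrt n)
      (fun s : Fin S => 2 * Real.sqrt 6 * 2 ^ ((s : ℕ) + 1) * κ s / (3 * Real.sqrt n)) :
      Fin (S + 1) → ℝ) s := by
    intro s
    refine Fin.cases ?_ (fun s => ?_) s
    · rw [Fin.cons_zero]
      positivity
    · rw [Fin.cons_succ]
      have := hκ_pos s
      positivity
  refine ⟨T, W, ⟨?_, by positivity, hLpos, fun j => ?_, fun s j hj => ?_, fun g => ?_⟩,
    fun s => ?_⟩
  · have : 0 ≤ ∑ s : Fin S, (2⁻¹ : ℝ) ^ (2 * ((s : ℕ) + 1)) / κ s :=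
      Finset.sum_nonneg fun s _ => div_nonneg (by positivity) (hκ_pos s).le
    positivity
  · obtain ⟨s, hs⟩ := T.cover j
    rcases hW s j hs with h | ⟨g, h⟩
    · rw [h]
      exact measurable_zero
    · rw [h]
      exact (hbk g).measurable_chainLabel hX s
  · rcases hW s j hj with h | ⟨g, h⟩
    · rw [h]
      exact bernsteinOrliczNorm_zero_le μ _ (by positivity)
    · rw [h]
      clear hj h
      induction s using Fin.cases with
      | zero =>
        rw [Fin.cons_zero]
        simpa using (hbk g).bernsteinOrliczNorm_chainLabel_zero_le hX hn hind (by linarith) (hB g)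
          ((hbr 0 (Nat.zero_le S)).2.1 rfl _)
      | succ s =>
        rw [Fin.cons_succ, hκκ' s]
        exact (hbk g).bernsteinOrliczNorm_chainLabel_succ_le hX hn hind hκ' s.2
  · obtain ⟨b, hb, hWb⟩ := hbranch g
    refine ⟨b, hb, fun ω => ?_⟩
    refine ((hbk g).abs_empiricalProcess_le hX hn hκ' ω).trans (le_of_eq ?_)
    have e1 : ∑ s, |W (b s) ω| = ∑ s ∈ Finset.range (S + 1),
        chainLabel μ X κ' S (l g) (u g) s ω := by
      rw [← Fin.sum_univ_eq_sum_range fun s => chainLabel μ X κ' S (l g) (u g) s ω]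
      exact Finset.sum_congr rfl fun s _ => by
        rw [hWb s, abs_of_nonneg (chainLabel_nonneg _ _)]
    have e2 : ∑ s : Fin S, (2⁻¹ : ℝ) ^ (2 * ((s : ℕ) + 1)) / κ s
        = ∑ s ∈ Finset.range S, 2⁻¹ ^ (2 * (s + 1)) / κ' s := by
      rw [← Fin.sum_univ_eq_sum_range fun s => (2⁻¹ : ℝ) ^ (2 * (s + 1)) / κ' s]
      exact Finset.sum_congr rfl fun s _ => by rw [hκκ' s]
    rw [e1, e2]
  · rw [hcard s, Nat.cast_prod]
    refine le_of_eq (Finset.prod_congr rfl fun k hk => (hbr k ?_).1)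
    have := Finset.mem_range.1 hk
    omega
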